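/- Let $G=(V,E)$ be a finite simple graph with $V=\{0,\dots,n-1\}$ and $m=|E|$, let $\varepsilon>0$, and let $\theta(v)\in\mathbb R$ be a threshold for each $v\in V$. For $S\subseteq V$ let $d_S(v)$ be the number of neighbours of $v$ in $S$. Let $\mathrm{Lap}(b)$ be the distribution with density $\frac1{2b}e^{-|x|/b}$, and for $0<q\le 1$ let $\mathrm{Geom}(q)$ be the distribution on $\{1,2,\dots\}$ with $\Pr[\mathrm{Geom}(q)=j]=(1-q)^{j-1}q$. *Naive loop.* Put $V_0=V$, $t=0$. Repeat: $t\leftarrow t+1$, $V_t\leftarrow V_{t-1}$; for each $v\in V_{t-1}$ draw a fresh independent $\nu_{t,v}\sim\mathrm{Lap}(8/\varepsilon)$ and, if $d_{V_{t-1}}(v)+\nu_{t,v}\le\theta(v)$, remove $v$ from $V_t$; until $V_{t-1}\setminus V_t=\emptyset$. *Resampling loop.* Put $t=0$, $V_0=V$, $\text{to-remove}(s)=\emptyset$ for all $s$, $\text{remove-time}(v)=n$ for all $v$, $\text{updated}=V$. Repeat: (i) for each $v\in\text{updated}$, delete $v$ from $\text{to-remove}(\text{remove-time}(v))$, let $q=\Pr[d_{V_t}(v)+\mathrm{Lap}(8/\varepsilon)\le\theta(v)]$,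 set $\text{remove-time}(v)\leftarrow t+\mathrm{Geom}(q)$ with a fresh independent draw, and add $v$ to $\text{to-remove}(\text{remove-time}(v))$; (ii) $\text{updated}\leftarrow\emptyset$, $t\leftarrow t+1$, $V_t\leftarrow V_{t-1}$; (iii) for each $v\in\text{to-remove}(t)$, remove $v$ from $V_t$ and add all neighbours of $v$ that are currently in $V_t$ to $\text{updated}$; until $V_{t-1}\setminus V_t=\emptyset$. (All for-loops go through their set in increasing order.) Then the following hold. 1. Both loops end after at most $n+1$ rounds. The sequence $(V_0,V_1,\dots)$ up to any number of rounds, together with the information whether the loop has ended, has the same distribution in both loops; in particular the final set has the same distribution in both. 2. The resampling loop can be implemented in $\tilde O(n+m)$ time. Precisely: (a) there is an absolute constant $C$ such that the resampling loop always performs at most $C(n+m+1)$ operations, where one resampling of a vertex in (i) counts 1, one removal of $v$ in (iii) counts $1+d_V(v)$, and each round counts 1; and (b) there are a fixed program $P$ and absolute constants $C,a$ such that for all $n,G,\varepsilon,\theta$, given $n$, $\varepsilon$, $\theta$ and adjacency lists of $G$ (in any order), $P$ halts with probability one within $C(n+m+1)\log^a(n+m+2)$ steps (with $\log=\lfloor\log_2\rfloor$)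 and outputs the number $T$ of rounds and the removal round of each vertex, i.e. $(V_0,\dots,V_T)$, with the distribution of the resampling loop. The program runs on a unit-cost random access machine whose registers and arrays hold natural numbers (with $+$, truncated $-$, comparison, indexing) and reals (with $+,-,\cdot,/,\exp$, comparison, and conversion from naturals), and which can draw from $\mathrm{Geom}(q)$ in one step. -/

import Mathlib

open MeasureTheory ProbabilityTheory

noncomputable section

namespace Peeling

/-! ### The two distributions -/

/-- The Laplace distribution `Lap(b)`, with density `exp (-|x| / b) / (2 b)`. -/
def laplace (b : ℝ) : Measure ℝ :=
  volume.withDensity fun x => ENNReal.ofReal (Real.exp (-|x| / b) / (2 * b))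

theorem isProbabilityMeasure_laplace {b : ℝ} (hb : 0 < b) :
    IsProbabilityMeasure (laplace b) := by
  have hne : b ≠ 0 := hb.ne'
  have hI : ∫ x : ℝ, Real.exp (-|x| / b) / (2 * b) = 1 := by
    rw [integral_comp_abs (f := fun x => Real.exp (-x / b) / (2 * b)), integral_div]
    have h := integral_exp_mul_Ioi (a := -b⁻¹) (by simpa using hb) 0
    have h2 : ∀ x : ℝ, Real.exp (-x / b) = Real.exp (-b⁻¹ * x) := by
      intro x; congr 1; field_simp
    simp_rw [h2, h]
    simp
    field_simp
  have hint : Integrable fun x : ℝ => Real.exp (-|x| / b) / (2 * b) := by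
    by_contra h
    rw [integral_undef h] at hI
    exact zero_ne_one hI
  refine ⟨?_⟩
  rw [laplace, withDensity_apply _ MeasurableSet.univ, Measure.restrict_univ,
    ← ofReal_integral_eq_lintegral_ofReal hint, hI, ENNReal.ofReal_one]
  exact Filter.Eventually.of_forall fun x => by positivity

/-- `Geom(q)`, the number of independent trials of success probability `q` up to and including
the first success, so that `Pr[Geom(q) = j + 1] = (1 - q) ^ j * q`. It is meant for `0 < q ≤ 1`;
other values of `q` are clamped to `[0, 1]`, and `Geom(0)` is by convention the constant `1`. -/
def geom (q : ℝ) : PMF ℕ :=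
  (geometricMeasure (Set.projIcc 0 1 zero_le_one q)).toPMF.map (· + 1)

/-! ### Repeat-until loops over randomized rounds -/

/-- A loop that maintains a set `V_t` of vertices: its current state, the list
`[V_0, V_1, ..., V_t]` of the sets seen so far, and whether the loop has been left. -/
structure LoopCfg (σ : Type) (n : ℕ) where
  state : σ
  trace : List (Finset (Fin n))
  done : Bool

/-- One more round of `repeat body until V_{t-1} - V_t = ∅`; nothing happens once the loop has
been left. -/
def LoopCfg.next {σ : Type} {n : ℕ} (body : σ → PMF σ) (cur : σ → Finset (Fin n))
    (c : LoopCfg σ n) : PMF (LoopCfg σ n) :=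
  if c.done = true then pure c
  else do
    let s ← body c.state
    pure ⟨s, c.trace ++ [cur s], decide (cur c.state \ cur s = ∅)⟩

/-- The loop, entered in state `s₀`, after (at most) `k` rounds. -/
def loopRun {σ : Type} {n : ℕ} (body : σ → PMF σ) (cur : σ → Finset (Fin n)) (s₀ : σ) :
    ℕ → PMF (LoopCfg σ n)
  | 0 => pure ⟨s₀, [cur s₀], false⟩
  | k + 1 => do
    let c ← loopRun body cur s₀ k
    c.next body cur

/-! ### The naive peeling loop -/

/-- The neighbours of `v` inside `S`. -/
def nbrsIn {n : ℕ} (G : SimpleGraph (Fin n)) (S : Finset (Fin n)) (v : Fin n) :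
    Finset (Fin n) :=
  open Classical in S.filter fun w => G.Adj v w

/-- The induced degree `d_S(v)`. -/
def indDeg {n : ℕ} (G : SimpleGraph (Fin n)) (S : Finset (Fin n)) (v : Fin n) : ℕ :=
  (nbrsIn G S v).card

theorem measurable_noisyTest (d θ : ℝ) : Measurable fun ν : ℝ => decide (d + ν ≤ θ) := by
  refine measurable_to_bool ?_
  have : (fun ν : ℝ => decide (d + ν ≤ θ)) ⁻¹' {true} = Set.Iic (θ - d) := by
    ext x; simp [le_sub_iff_add_le']
  rw [this]
  exact measurableSet_Iic

/-- Draw `ν ← Lap(8 / ε)` afresh and return the truth value of `d + ν ≤ θ`. -/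
def noisyTest (ε : ℝ) (hε : 0 < ε) (d θ : ℝ) : PMF Bool :=
  haveI := isProbabilityMeasure_laplace (b := 8 / ε) (by positivity)
  haveI : IsProbabilityMeasure ((laplace (8 / ε)).map fun ν => decide (d + ν ≤ θ)) :=
    Measure.isProbabilityMeasure_map (measurable_noisyTest d θ).aemeasurable
  ((laplace (8 / ε)).map fun ν => decide (d + ν ≤ θ)).toPMF

/-- One round of the naive loop: `V_t ← V_{t-1}`, then for each `v ∈ V_{t-1}` draw
`ν ← Lap(8 / ε)` and remove `v` from `V_t` if `d_{V_{t-1}}(v) + ν ≤ thr v`. -/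
def naiveBody {n : ℕ} (G : SimpleGraph (Fin n)) (ε : ℝ) (hε : 0 < ε) (thr : Fin n → ℝ)
    (V : Finset (Fin n)) : PMF (Finset (Fin n)) :=
  (V.sort (· ≤ ·)).foldlM (init := V) fun W v => do
    let b ← noisyTest ε hε (indDeg G V v) (thr v)
    pure (if b = true then W.erase v else W)

/-- The naive loop on `G`, from `V_0 = V`, after at most `k` rounds. -/
def naiveRun {n : ℕ} (G : SimpleGraph (Fin n)) (ε : ℝ) (hε : 0 < ε) (thr : Fin n → ℝ) :
    ℕ → PMF (LoopCfg (Finset (Fin n)) n) :=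
  loopRun (naiveBody G ε hε thr) id Finset.univ

/-! ### The loop with geometric resampling -/

/-- The variables of the loop with geometric resampling, and a counter `work` of the executed
lines, on which the loop does not depend: a resampling counts `1`, the removal of `v` counts `1`
plus the number of neighbours of `v` that have to be scanned, and a round counts `1`. -/
structure EffState (n : ℕ) where
  t : ℕ
  V : Finset (Fin n)
  toRemove : ℕ → Finset (Fin n)
  removeTime : Fin n → ℕ
  updated : Finset (Fin n)
  work : ℕ

def EffState.start (n : ℕ) : EffState n where
  t := 0
  V := Finset.univ
  toRemove := fun _ => ∅
  removeTime := fun _ => n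
  updated := Finset.univ
  work := 0

/-- Take `v` out of `toRemove (removeTime v)`, compute the probability `q` that
`d_{V_t}(v) + Lap(8 / ε) ≤ thr v`, set `removeTime v ← t + Geom(q)`, and put `v` into
`toRemove (removeTime v)`. -/
def resample {n : ℕ} (G : SimpleGraph (Fin n)) (ε : ℝ) (thr : Fin n → ℝ)
    (s : EffState n) (v : Fin n) : PMF (EffState n) := do
  let old := Function.update s.toRemove (s.removeTime v) ((s.toRemove (s.removeTime v)).erase v)
  let q := (laplace (8 / ε)).real {ν : ℝ | (indDeg G s.V v : ℝ) + ν ≤ thr v}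
  let g ← geom q
  pure { s with
    toRemove := Function.update old (s.t + g) (insert v (old (s.t + g)))
    removeTime := Function.update s.removeTime v (s.t + g)
    work := s.work + 1 }

/-- Remove `v` from `V_t` and add all neighbours of `v` in `V_t` to `updated`. -/
def removeVertex {n : ℕ} (G : SimpleGraph (Fin n)) (s : EffState n) (v : Fin n) : EffState n :=
  { s with
    V := s.V.erase v
    updated := s.updated ∪ nbrsIn G (s.V.erase v) v
    work := s.work + 1 + indDeg G Finset.univ v }

/-- One round: resample the removal time of each `v ∈ updated`, which empties `updated`;
advance `t`; process the vertices in `toRemove t`. -/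
def effBody {n : ℕ} (G : SimpleGraph (Fin n)) (ε : ℝ) (thr : Fin n → ℝ)
    (s : EffState n) : PMF (EffState n) := do
  let s₁ ← (s.updated.sort (· ≤ ·)).foldlM (resample G ε thr) s
  let s₂ : EffState n := { s₁ with t := s₁.t + 1, updated := ∅, work := s₁.work + 1 }
  pure (((s₂.toRemove s₂.t).sort (· ≤ ·)).foldl (removeVertex G) s₂)

/-- The loop with geometric resampling on `G`, after at most `k` rounds. -/
def effRun {n : ℕ} (G : SimpleGraph (Fin n)) (ε : ℝ) (thr : Fin n → ℝ) :
    ℕ → PMF (LoopCfg (EffState n) n) :=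
  loopRun (effBody G ε thr) EffState.V (EffState.start n)

/-- What is observed of a loop: the sets `V_0, ..., V_t` and whether the loop has been left. -/
def LoopCfg.observe {σ : Type} {n : ℕ} (c : LoopCfg σ n) : List (Finset (Fin n)) × Bool :=
  (c.trace, c.done)

/-! ### A randomized real RAM

Registers and arrays hold natural numbers or reals. Naturals can be added, subtracted, compared
and used as addresses; reals can be added, subtracted, multiplied, divided, exponentiated and
compared. A natural can be converted to a real; the only way back is the instruction that
draws from `Geom(q)`. One instruction or one test is one step; a program is a fixed finite
text, so the expressions in it have bounded size. -/

/-- The memory. -/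
structure Store where
  natReg : ℕ → ℕ
  natArr : ℕ → ℕ → ℕ
  realReg : ℕ → ℝ
  realArr : ℕ → ℕ → ℝ

inductive NExp where
  | const (k : ℕ)
  | reg (x : ℕ)
  | get (a : ℕ) (i : NExp)
  | add (e f : NExp)
  | sub (e f : NExp)

def NExp.eval (σ : Store) : NExp → ℕ
  | .const k => k
  | .reg x => σ.natReg x
  | .get a i => σ.natArr a (i.eval σ)
  | .add e f => e.eval σ + f.eval σ
  | .sub e f => e.eval σ - f.eval σ

inductive RExp where
  | ofNat (e : NExp)
  | reg (x : ℕ)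
  | get (a : ℕ) (i : NExp)
  | add (e f : RExp)
  | sub (e f : RExp)
  | mul (e f : RExp)
  | div (e f : RExp)
  | exp (e : RExp)

def RExp.eval (σ : Store) : RExp → ℝ
  | .ofNat e => (e.eval σ : ℝ)
  | .reg x => σ.realReg x
  | .get a i => σ.realArr a (i.eval σ)
  | .add e f => e.eval σ + f.eval σ
  | .sub e f => e.eval σ - f.eval σ
  | .mul e f => e.eval σ * f.eval σ
  | .div e f => e.eval σ / f.eval σ
  | .exp e => Real.exp (e.eval σ)

inductive BExp where
  | natLe (e f : NExp)
  | realLe (e f : RExp)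
  | not (b : BExp)
  | and (b c : BExp)

def BExp.holds (σ : Store) : BExp → Prop
  | .natLe e f => e.eval σ ≤ f.eval σ
  | .realLe e f => e.eval σ ≤ f.eval σ
  | .not b => ¬ b.holds σ
  | .and b c => b.holds σ ∧ c.holds σ

inductive Cmd where
  | skip
  | setNat (x : ℕ) (e : NExp)
  | putNat (a : ℕ) (i e : NExp)
  | setReal (x : ℕ) (e : RExp)
  | putReal (a : ℕ) (i : NExp) (e : RExp)
  | sampleGeom (x : ℕ) (q : RExp)
  | seq (c d : Cmd)
  | ite (b : BExp) (c d : Cmd)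
  | while (b : BExp) (c : Cmd)

def Store.setNat (σ : Store) (x v : ℕ) : Store :=
  { σ with natReg := Function.update σ.natReg x v }

def Store.putNat (σ : Store) (a i v : ℕ) : Store :=
  { σ with natArr := Function.update σ.natArr a (Function.update (σ.natArr a) i v) }

def Store.setReal (σ : Store) (x : ℕ) (v : ℝ) : Store :=
  { σ with realReg := Function.update σ.realReg x v }

def Store.putReal (σ : Store) (a i : ℕ) (v : ℝ) : Store :=
  { σ with realArr := Function.update σ.realArr a (Function.update (σ.realArr a) i v) }

/-- One step of the machine. A configuration is the list of the commands still to be executed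
and the memory; the machine has halted when the list is empty. -/
def step : List Cmd × Store → PMF (List Cmd × Store)
  | ([], σ) => pure ([], σ)
  | (.skip :: K, σ) => pure (K, σ)
  | (.setNat x e :: K, σ) => pure (K, σ.setNat x (e.eval σ))
  | (.putNat a i e :: K, σ) => pure (K, σ.putNat a (i.eval σ) (e.eval σ))
  | (.setReal x e :: K, σ) => pure (K, σ.setReal x (e.eval σ))
  | (.putReal a i e :: K, σ) => pure (K, σ.putReal a (i.eval σ) (e.eval σ))
  | (.sampleGeom x q :: K, σ) => do
    let g ← geom (q.eval σ)
    pure (K, σ.setNat x g)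
  | (.seq c d :: K, σ) => pure (c :: d :: K, σ)
  | (.ite b c d :: K, σ) =>
    open Classical in pure (if b.holds σ then c :: K else d :: K, σ)
  | (.while b c :: K, σ) =>
    open Classical in pure (if b.holds σ then c :: .while b c :: K else K, σ)

/-- The configuration after `T` steps. -/
def runFor (p : List Cmd × Store) : ℕ → PMF (List Cmd × Store)
  | 0 => pure p
  | T + 1 => do
    let p' ← runFor p T
    step p'

/-- `nbrs v` lists the neighbours of `v`, in any order and without repetition. -/
def IsAdjacencyLists {n : ℕ} (G : SimpleGraph (Fin n)) (nbrs : Fin n → List (Fin n)) : Prop :=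
  ∀ v, (nbrs v).Nodup ∧ ∀ w, w ∈ nbrs v ↔ G.Adj v w

/-- The input: natural register `0` holds `n`, real register `0` holds `ε`, real array `0` holds
the thresholds, natural array `1` holds the concatenated adjacency lists, and cell `v ≤ n` of
natural array `0` holds the position at which the list of `v` starts in it (so the list of `v`
ends just before the position in cell `v + 1`). All other cells are `0`. -/
def inputStore {n : ℕ} (nbrs : Fin n → List (Fin n)) (ε : ℝ) (thr : Fin n → ℝ) : Store where
  natReg := fun x => if x = 0 then n else 0
  natArr := fun a i =>
    if a = 0 then (if i ≤ n then ((List.ofFn nbrs).take i).flatten.length else 0)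
    else if a = 1 then ((List.ofFn nbrs).flatten.map Fin.val).getD i 0
    else 0
  realReg := fun x => if x = 0 then ε else 0
  realArr := fun a i => if h : a = 0 ∧ i < n then thr ⟨i, h.2⟩ else 0

/-- The output: natural register `1` holds the number `T` of rounds, and cell `v` of natural
array `2` holds the round in which `v` was removed, or `0` if `v ∈ V_T`. This encodes the sets
`[V_0, ..., V_T]`. There is no output (`none`) unless the machine has halted. -/
def outputTrace (n : ℕ) (p : List Cmd × Store) : Option (List (Finset (Fin n))) :=
  if p.1.isEmpty = true then
    some ((List.range (p.2.natReg 1 + 1)).map fun s =>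
      Finset.univ.filter fun v : Fin n => p.2.natArr 2 v = 0 ∨ s < p.2.natArr 2 v)
  else none

end Peeling

end

noncomputable section

namespace Peeling

/-! ### Generalities on probability mass functions -/

/-! The proof is a statement about laws, resting on the memorylessness of the geometric
distribution. As long as the degree of `v` does not change, the naive loop tosses coins of the same
bias `q` for `v`, so the round of its removal is the current round plus a `Geom(q)` variable. Let
all current vertices have independent removal times of this kind. Revealing whether each time equals
the next round amounts to one naive round, and the survivors are left with independent geometric
times counted from that round (`geom_removalProb_eq_bind`, `sampSet_eq_peel_bind`). Their biases
still belong to the old set. Only the neighbours of removed vertices have a wrong bias, and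
redrawing one of several independent coordinates replaces the law of that coordinate and leaves the
others alone (`sampSet_bind_samp`). Hence the invariant returns, and induction on the number of
rounds gives `sampSet_bind_effObs`. Already removed vertices that are redrawn only influence a
background on which no observation depends.

Both loops stop because every round but the last removes a vertex. The work bound is a potential
argument: a vertex leaves a bucket at most twice, each time at a cost linear in its degree.

The machine runs a variant (`lazyTrace`) that redraws only surviving neighbours of removed vertices,
as soon as they are scanned. It has the trace law of the naive loop for the same reason
(`sampSet_bind_lazyTrace`). A vertex scanned several times in a round is drawn several times, and
only its last draw matters; that one is made with the final degree. Buckets are linked lists in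
which stale entries stay and are skipped. Every entry prepays its later visit, which makes the
running time linear without a logarithm. -/

theorem pmf_bind_congr {α β : Type*} (p : PMF α) {f g : α → PMF β}
    (h : ∀ a ∈ p.support, f a = g a) : p.bind f = p.bind g := by
  ext b
  rw [PMF.bind_apply, PMF.bind_apply]
  refine tsum_congr fun a => ?_
  by_cases ha : a ∈ p.support
  · rw [h a ha]
  · rw [(PMF.apply_eq_zero_iff p a).2 ha, zero_mul, zero_mul]

theorem pmf_map_congr {α β : Type*} (p : PMF α) {f g : α → β}
    (h : ∀ a ∈ p.support, f a = g a) : p.map f = p.map g :=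
  pmf_bind_congr p fun a ha => by simp [h a ha]

/-! ### Independent resampling of finitely many removal times -/

section Samp

variable {ι : Type} [DecidableEq ι]

/-- Set `τ v` to `t` plus a fresh sample of `p v`, for each `v` in the list. -/
def samp (p : ι → PMF ℕ) (t : ℕ) : List ι → (ι → ℕ) → PMF (ι → ℕ)
  | [], τ => PMF.pure τ
  | v :: l, τ => (p v).bind fun g => samp p t l (Function.update τ v (t + g))

/-- Draws for different coordinates commute, and for equal coordinates there is nothing to swap.
This makes resampling over a finite set meaningful without an order. -/
theorem samp_perm (p : ι → PMF ℕ) (t : ℕ) {l l' : List ι} (h : l.Perm l') :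
    samp p t l = samp p t l' := by
  induction h with
  | nil => rfl
  | cons v _ ih => funext τ; simp only [samp, ih]
  | swap v w l =>
    funext τ
    by_cases hvw : v = w
    · subst hvw; rfl
    · simp only [samp]
      rw [PMF.bind_comm]
      simp only [Function.update_comm hvw]
  | trans _ _ ih₁ ih₂ => rw [ih₁, ih₂]

/-- The old value is overwritten by the fresh draw. This is what allows a vertex to be drawn
prematurely, or several times in one round. -/
theorem samp_update_of_mem (p : ι → PMF ℕ) (t : ℕ) {l : List ι} {v : ι} (hv : v ∈ l)
    (τ : ι → ℕ) (x : ℕ) : samp p t l (Function.update τ v x) = samp p t l τ := by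
  induction l generalizing τ with
  | nil => simp at hv
  | cons w l ih =>
    by_cases hwv : v = w
    · subst hwv; simp [samp]
    · simp only [samp, Function.update_comm hwv]
      exact congrArg _ (funext fun g => ih (by simpa [hwv] using hv) _)

theorem samp_congr {p p' : ι → PMF ℕ} (t : ℕ) {l : List ι} (h : ∀ v ∈ l, p v = p' v)
    (τ : ι → ℕ) : samp p t l τ = samp p' t l τ := by
  induction l generalizing τ with
  | nil => rfl
  | cons w l ih =>
    simp only [samp, h w (by simp)]
    exact congrArg _ (funext fun g => ih (fun v hv => h v (by simp [hv])) _)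

theorem samp_support {p : ι → PMF ℕ} (hp : ∀ v, ∀ g ∈ (p v).support, 1 ≤ g) (t : ℕ) {l : List ι}
    {τ τ' : ι → ℕ} (h : τ' ∈ (samp p t l τ).support) :
    (∀ v, v ∉ l → τ' v = τ v) ∧ ∀ v ∈ l, t < τ' v := by
  induction l generalizing τ with
  | nil => simp [samp] at h; simp [h]
  | cons w l ih =>
    simp only [samp, PMF.mem_support_bind_iff] at h
    obtain ⟨g, hg, h⟩ := h
    obtain ⟨h₁, h₂⟩ := ih h
    refine ⟨fun v hv => ?_, fun v hv => ?_⟩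
    · simp only [List.mem_cons, not_or] at hv
      rw [h₁ v hv.2, Function.update_of_ne hv.1]
    · by_cases hvl : v ∈ l
      · exact h₂ v hvl
      · have hvw : v = w := by simpa [hvl] using hv
        subst hvw
        rw [h₁ v hvl, Function.update_self]
        have := hp v g hg
        omega

/-- `samp` over a finite set. -/
def sampSet (p : ι → PMF ℕ) (t : ℕ) (S : Finset ι) (τ : ι → ℕ) : PMF (ι → ℕ) :=
  samp p t S.toList τ

theorem samp_eq_sampSet (p : ι → PMF ℕ) (t : ℕ) {l : List ι} {S : Finset ι} (hl : l.Nodup)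
    (h : ∀ v, v ∈ l ↔ v ∈ S) : samp p t l = sampSet p t S := by
  funext τ
  rw [sampSet, samp_perm p t ((List.perm_ext_iff_of_nodup hl S.nodup_toList).2 (by simpa using h))]

theorem sampSet_empty (p : ι → PMF ℕ) (t : ℕ) (τ : ι → ℕ) :
    sampSet p t ∅ τ = PMF.pure τ := by
  simp [sampSet, samp]

theorem sampSet_insert (p : ι → PMF ℕ) (t : ℕ) {S : Finset ι} {v : ι} (hv : v ∉ S) (τ : ι → ℕ) :
    sampSet p t (insert v S) τ =
      (p v).bind fun g => sampSet p t S (Function.update τ v (t + g)) := by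
  rw [sampSet, samp_perm p t (Finset.toList_insert hv)]
  rfl

theorem sampSet_update_of_mem (p : ι → PMF ℕ) (t : ℕ) {S : Finset ι} {v : ι} (hv : v ∈ S)
    (τ : ι → ℕ) (x : ℕ) : sampSet p t S (Function.update τ v x) = sampSet p t S τ :=
  samp_update_of_mem p t (by simpa using hv) τ x

theorem sampSet_congr {p p' : ι → PMF ℕ} (t : ℕ) {S : Finset ι} (h : ∀ v ∈ S, p v = p' v)
    (τ : ι → ℕ) : sampSet p t S τ = sampSet p' t S τ :=
  samp_congr t (by simpa using h) τ

theorem sampSet_support {p : ι → PMF ℕ} (hp : ∀ v, ∀ g ∈ (p v).support, 1 ≤ g) (t : ℕ)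
    {S : Finset ι} {τ τ' : ι → ℕ} (h : τ' ∈ (sampSet p t S τ).support) :
    (∀ v, v ∉ S → τ' v = τ v) ∧ ∀ v ∈ S, t < τ' v := by
  simpa using samp_support hp t h

/-- A draw for a coordinate outside `S` commutes with every draw inside `S`, so it can be made first
and absorbed into the starting point. -/
theorem sampSet_bind_resample_notMem (p : ι → PMF ℕ) (q : PMF ℕ) (t : ℕ) {S : Finset ι} {v : ι}
    (hv : v ∉ S) (τ : ι → ℕ) :
    ((sampSet p t S τ).bind fun τ' => q.bind fun g => PMF.pure (Function.update τ' v (t + g))) =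
      q.bind fun g => sampSet p t S (Function.update τ v (t + g)) := by
  have key : ∀ (l : List ι) (τ : ι → ℕ), v ∉ l →
      ((samp p t l τ).bind fun τ' => q.bind fun g => PMF.pure (Function.update τ' v (t + g))) =
      q.bind fun g => samp p t l (Function.update τ v (t + g)) := by
    intro l
    induction l with
    | nil => intro τ _; simp [samp]
    | cons w l ih =>
      intro τ hl
      simp only [List.mem_cons, not_or] at hl
      simp only [samp, PMF.bind_bind, ih _ hl.2, Function.update_comm hl.1]
      rw [PMF.bind_comm]
  exact key _ _ (by simpa using hv)

/-- Resampling one of independent removal times only changes the law of that removal time. -/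
theorem sampSet_bind_resample_mem (p : ι → PMF ℕ) (q : PMF ℕ) (t : ℕ) {S : Finset ι} {v : ι}
    (hv : v ∈ S) (τ : ι → ℕ) :
    ((sampSet p t S τ).bind fun τ' => q.bind fun g => PMF.pure (Function.update τ' v (t + g))) =
      sampSet (Function.update p v q) t S τ := by
  obtain ⟨S, hvS, rfl⟩ : ∃ S', v ∉ S' ∧ insert v S' = S :=
    ⟨S.erase v, by simp, Finset.insert_erase hv⟩
  rw [sampSet_insert _ _ hvS, sampSet_insert _ _ hvS]
  -- The original draw of `v` is overwritten, so integrating it out leaves a constant bind.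
  simp only [Function.update_self, PMF.bind_bind, sampSet_bind_resample_notMem _ _ _ hvS,
    Function.update_idem, PMF.bind_const]
  refine congrArg _ (funext fun g => sampSet_congr t (fun w hw => ?_) _)
  rw [Function.update_of_ne (by rintro rfl; exact hvS hw)]

/-- Resampling the times of the elements of a list: the elements of `S` keep independent times,
the others become part of the deterministic background of `sampSet`. -/
theorem sampSet_bind_samp (p p' : ι → PMF ℕ) (t : ℕ) (S : Finset ι) (l : List ι) :
    ∃ bg : (ι → ℕ) → PMF (ι → ℕ), ∀ τ,
      (sampSet p t S τ).bind (samp p' t l) =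
        (bg τ).bind (sampSet (fun v => if v ∈ l then p' v else p v) t S) := by
  induction l generalizing p with
  | nil => exact ⟨PMF.pure, fun τ => by simp [samp]⟩
  | cons w l ih =>
    have hsplit : ∀ τ, (sampSet p t S τ).bind (samp p' t (w :: l)) =
        ((sampSet p t S τ).bind fun τ' => (p' w).bind fun g =>
          PMF.pure (Function.update τ' w (t + g))).bind (samp p' t l) := by
      intro τ; simp only [samp, PMF.bind_bind, PMF.pure_bind]
    by_cases hw : w ∈ S
    · obtain ⟨bg, hbg⟩ := ih (Function.update p w (p' w))
      refine ⟨bg, fun τ => ?_⟩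
      rw [hsplit, sampSet_bind_resample_mem _ _ _ hw, hbg]
      congr 1
      funext τ'
      refine sampSet_congr t (fun v _ => ?_) τ'
      by_cases hvw : v = w
      · subst hvw; simp
      · simp [hvw]
    · obtain ⟨bg, hbg⟩ := ih p
      -- For `w` outside `S` the draw is moved to the front, where it randomizes the background.
      refine ⟨fun τ => (p' w).bind fun g => bg (Function.update τ w (t + g)), fun τ => ?_⟩
      rw [hsplit, sampSet_bind_resample_notMem _ _ _ hw]
      simp only [PMF.bind_bind, hbg]
      congr 1; funext g; congr 1; funext τ'
      refine sampSet_congr t (fun v hv => ?_) τ'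
      have hvw : v ≠ w := by rintro rfl; exact hw hv
      simp [hvw]

/-! ### Revealing geometric times one round at a time -/

/-- Toss a coin for each element of the list, and remove it from `W` on success. -/
def peel (coin : ι → PMF Bool) : List ι → Finset ι → PMF (Finset ι)
  | [], W => PMF.pure W
  | v :: l, W => (coin v).bind fun b => peel coin l (if b = true then W.erase v else W)

theorem peel_support {coin : ι → PMF Bool} {l : List ι} {W W' : Finset ι}
    (h : W' ∈ (peel coin l W).support) : W' ⊆ W ∧ ∀ v ∈ W, v ∉ l → v ∈ W' := by
  induction l generalizing W with
  | nil => simp [peel] at h; simp [h]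
  | cons w l ih =>
    simp only [peel, PMF.mem_support_bind_iff] at h
    obtain ⟨b, _, h⟩ := h
    obtain ⟨h₁, h₂⟩ := ih h
    cases b
    · exact ⟨by simpa using h₁, fun v hv hl => h₂ v (by simpa using hv) (by simp_all)⟩
    · exact ⟨h₁.trans (by simpa using W.erase_subset w), fun v hv hl => h₂ v (by simp_all) (by simp_all)⟩

/-- Independent geometric removal times, revealed for one round: first toss the coins of that
round, then draw the times of the survivors afresh, one round later. -/
theorem samp_eq_peel_bind {p : ι → PMF ℕ} {coin : ι → PMF Bool}
    (hp : ∀ v, p v = (coin v).bind fun b =>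
      if b = true then PMF.pure 1 else (p v).map (· + 1))
    (t : ℕ) {l : List ι} (hl : l.Nodup) (W : Finset ι) (hW : ∀ v ∈ l, v ∈ W) (τ : ι → ℕ) :
    samp p t l τ = (peel coin l W).bind fun W' =>
      samp p (t + 1) (l.filter (· ∈ W')) fun v => if v ∈ l ∧ v ∉ W' then t + 1 else τ v := by
  induction l generalizing W τ with
  | nil => simp [samp, peel]
  | cons v l ih =>
    obtain ⟨hvl, hl⟩ := List.nodup_cons.1 hl
    have hlW : ∀ w ∈ l, w ∈ W := fun w hw => hW w (by simp [hw])
    rw [samp, hp v, peel, PMF.bind_bind, PMF.bind_bind]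
    congr 1
    funext b
    cases b
    · simp only [Bool.false_eq_true, if_false, PMF.bind_map, Function.comp_def]
      simp_rw [ih hl W hlW]
      -- The remaining waiting time of `v` is drawn before the other coins on one side and after
      -- them on the other.
      rw [PMF.bind_comm]
      refine pmf_bind_congr _ fun W' hW' => ?_
      have hvW' : v ∈ W' := (peel_support hW').2 v (hW v (by simp)) hvl
      rw [List.filter_cons_of_pos (by simpa using hvW')]
      simp only [samp]
      congr 1; funext g; congr 1; funext w
      by_cases hwv : w = v
      -- After a failed coin the time is `t + (g + 1) = (t + 1) + g`.
      · subst hwv; simp [hvl]; ring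
      · simp [hwv]
    · simp only [if_true, PMF.pure_bind]
      rw [ih hl (W.erase v) fun w hw => Finset.mem_erase.2 ⟨by rintro rfl; exact hvl hw, hlW w hw⟩]
      refine pmf_bind_congr _ fun W' hW' => ?_
      have hvW' : v ∉ W' := fun h => by simpa using (peel_support hW').1 h
      rw [List.filter_cons_of_neg (by simpa using hvW')]
      congr 1; funext w
      by_cases hwv : w = v
      · subst hwv; simp [hvl, hvW']
      · simp [hwv]

theorem sampSet_eq_peel_bind {p : ι → PMF ℕ} {coin : ι → PMF Bool}
    (hp : ∀ v, p v = (coin v).bind fun b =>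
      if b = true then PMF.pure 1 else (p v).map (· + 1))
    (t : ℕ) {l : List ι} (hl : l.Nodup) {V : Finset ι} (hV : ∀ v, v ∈ l ↔ v ∈ V) (τ : ι → ℕ) :
    sampSet p t V τ = (peel coin l V).bind fun V' =>
      sampSet p (t + 1) V' fun v => if v ∈ V ∧ v ∉ V' then t + 1 else τ v := by
  rw [← samp_eq_sampSet p t hl hV, samp_eq_peel_bind hp t hl V (fun v hv => (hV v).1 hv)]
  refine pmf_bind_congr _ fun V' hV' => ?_
  simp only [hV]
  rw [samp_eq_sampSet p (t + 1) (hl.filter _)]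
  intro v
  simp only [List.mem_filter, decide_eq_true_eq, hV, and_iff_right_iff_imp]
  exact fun h => (peel_support hV').1 h

end Samp

/-! ### Loops -/

section Loops

variable {σ : Type} {n : ℕ}

/-- The loop, continued from a given configuration for `k` rounds. -/
def loopFrom (body : σ → PMF σ) (cur : σ → Finset (Fin n)) :
    ℕ → LoopCfg σ n → PMF (LoopCfg σ n)
  | 0, c => PMF.pure c
  | k + 1, c => (c.next body cur).bind (loopFrom body cur k)

/-- `loopRun` appends rounds at the end, while inductions over all starting states need to split off
the first round; associativity of bind reconciles the two. -/
theorem loopFrom_succ_last (body : σ → PMF σ) (cur : σ → Finset (Fin n)) (k : ℕ)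
    (c : LoopCfg σ n) :
    loopFrom body cur (k + 1) c = (loopFrom body cur k c).bind fun c' => c'.next body cur := by
  induction k generalizing c with
  | zero => simp only [loopFrom, PMF.pure_bind]; exact PMF.bind_pure _
  | succ k ih =>
    change (c.next body cur).bind (loopFrom body cur (k + 1)) = PMF.bind (PMF.bind _ _) _
    rw [PMF.bind_bind]
    exact congrArg _ (funext ih)

theorem loopRun_eq_loopFrom (body : σ → PMF σ) (cur : σ → Finset (Fin n)) (s₀ : σ) (k : ℕ) :
    loopRun body cur s₀ k = loopFrom body cur k ⟨s₀, [cur s₀], false⟩ := by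
  induction k with
  | zero => rfl
  | succ k ih => rw [loopFrom_succ_last, ← ih]; rfl

theorem loopFrom_of_done (body : σ → PMF σ) (cur : σ → Finset (Fin n)) (k : ℕ)
    {c : LoopCfg σ n} (hc : c.done = true) : loopFrom body cur k c = PMF.pure c := by
  induction k with
  | zero => rfl
  | succ k ih =>
    rw [loopFrom, LoopCfg.next, if_pos hc]
    exact (PMF.pure_bind _ _).trans ih

theorem loopFrom_succ (body : σ → PMF σ) (cur : σ → Finset (Fin n)) (k : ℕ) (s : σ)
    (tr : List (Finset (Fin n))) :
    loopFrom body cur (k + 1) ⟨s, tr, false⟩ = (body s).bind fun s' =>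
      loopFrom body cur k ⟨s', tr ++ [cur s'], decide (cur s \ cur s' = ∅)⟩ := by
  rw [loopFrom, LoopCfg.next, if_neg (by simp)]
  change (PMF.bind _ _).bind _ = _
  rw [PMF.bind_bind]
  congr 1; funext s'
  exact PMF.pure_bind _ _

/-- A loop whose sets decrease is left after at most `n + 1` rounds. -/
theorem done_of_mem_support_loopRun {body : σ → PMF σ} {cur : σ → Finset (Fin n)}
    (hbody : ∀ s, ∀ s' ∈ (body s).support, cur s' ⊆ cur s) (s₀ : σ) :
    ∀ c ∈ (loopRun body cur s₀ (n + 1)).support, c.done = true := by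
  -- Every round that does not end the loop loses a vertex, so `k` unfinished rounds cost at least
  -- `k` vertices.
  have key : ∀ k c, ∀ c' ∈ (loopFrom body cur k c).support,
      c'.done = true ∨ (cur c'.state).card + k ≤ (cur c.state).card := by
    intro k
    induction k with
    | zero => intro c c' h; simp [loopFrom] at h; simp [h]
    | succ k ih =>
      rintro ⟨s, tr, d⟩ c' h
      cases d
      · rw [loopFrom_succ, PMF.mem_support_bind_iff] at h
        obtain ⟨s', hs', h⟩ := h
        by_cases he : cur s \ cur s' = ∅
        · rw [loopFrom_of_done _ _ _ (by simpa using he)] at h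
          simp only [PMF.support_pure, Set.mem_singleton_iff] at h
          left; rw [h]; simpa using he
        · refine (ih _ c' h).imp_right fun h' => ?_
          have : (cur s').card < (cur s).card := Finset.card_lt_card
            ⟨hbody s s' hs', fun hc => he (Finset.sdiff_eq_empty_iff_subset.2 hc)⟩
          simp only at h' ⊢
          omega
      · rw [loopFrom_of_done _ _ _ rfl] at h
        simp only [PMF.support_pure, Set.mem_singleton_iff] at h
        exact Or.inl (by rw [h])
  intro c hc
  rw [loopRun_eq_loopFrom] at hc
  refine (key _ _ c hc).resolve_right fun h => ?_
  have : (cur s₀).card ≤ n := (Finset.card_le_univ _).trans (by simp)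
  simp only at h
  omega

/-- Makes the final set a function of the trace, so that equality of trace laws transfers to it. -/
theorem getLast_trace_of_mem_support_loopRun (body : σ → PMF σ) (cur : σ → Finset (Fin n))
    (s₀ : σ) (k : ℕ) :
    ∀ c ∈ (loopRun body cur s₀ k).support, c.trace.getLast? = some (cur c.state) := by
  induction k with
  | zero =>
    intro c hc
    have hc : c ∈ (PMF.pure (⟨s₀, [cur s₀], false⟩ : LoopCfg σ n)).support := hc
    simp only [PMF.support_pure, Set.mem_singleton_iff] at hc
    simp [hc]
  | succ k ih =>
    intro c' hc'
    have hc' : c' ∈ ((loopRun body cur s₀ k).bind fun c => c.next body cur).support := hc'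
    rw [PMF.mem_support_bind_iff] at hc'
    obtain ⟨c, hc, h⟩ := hc'
    unfold LoopCfg.next at h
    split_ifs at h with hd
    · have h : c' ∈ (PMF.pure c).support := h
      simp only [PMF.support_pure, Set.mem_singleton_iff] at h
      rw [h]; exact ih c hc
    · have h : c' ∈ ((body c.state).bind fun s => PMF.pure
        (⟨s, c.trace ++ [cur s], decide (cur c.state \ cur s = ∅)⟩ : LoopCfg σ n)).support := h
      rw [PMF.mem_support_bind_iff] at h
      obtain ⟨s, _, h⟩ := h
      simp only [PMF.support_pure, Set.mem_singleton_iff] at h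
      simp [h]

end Loops

/-! ### The Laplace and geometric distributions -/

theorem laplace_real_apply {b : ℝ} (hb : 0 < b) {s : Set ℝ} (hs : MeasurableSet s) :
    (laplace b).real s = ∫ x in s, Real.exp (-|x| / b) / (2 * b) := by
  rw [Measure.real, laplace, withDensity_apply _ hs,
    integral_eq_lintegral_of_nonneg_ae]
  · exact Filter.Eventually.of_forall fun x => by positivity
  · exact (by fun_prop : Continuous fun x : ℝ => Real.exp (-|x| / b) / (2 * b)).aestronglyMeasurable

theorem laplace_real_Iic_of_nonpos {b : ℝ} (hb : 0 < b) {x : ℝ} (hx : x ≤ 0) :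
    (laplace b).real (Set.Iic x) = Real.exp (x / b) / 2 := by
  have h : ∀ y ∈ Set.Iic x, Real.exp (-|y| / b) / (2 * b) = Real.exp (b⁻¹ * y) / (2 * b) := by
    intro y hy
    rw [abs_of_nonpos (le_trans hy hx)]
    congr 2; field_simp
  rw [laplace_real_apply hb measurableSet_Iic, setIntegral_congr_fun measurableSet_Iic h,
    integral_div, integral_exp_mul_Iic (inv_pos.2 hb)]
  have : b⁻¹ * x = x / b := by ring
  rw [this]
  field_simp

theorem laplace_real_Iic_of_nonneg {b : ℝ} (hb : 0 < b) {x : ℝ} (hx : 0 ≤ x) :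
    (laplace b).real (Set.Iic x) = 1 - Real.exp (-x / b) / 2 := by
  have := isProbabilityMeasure_laplace hb
  have h : ∀ y ∈ Set.Ioi x, Real.exp (-|y| / b) / (2 * b) = Real.exp (-b⁻¹ * y) / (2 * b) := by
    intro y hy
    rw [abs_of_nonneg (le_trans hx (le_of_lt hy))]
    congr 2; field_simp
  have hI : (laplace b).real (Set.Ioi x) = Real.exp (-x / b) / 2 := by
    rw [laplace_real_apply hb measurableSet_Ioi, setIntegral_congr_fun measurableSet_Ioi h,
      integral_div, integral_exp_mul_Ioi (by simpa using hb)]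
    have : -b⁻¹ * x = -x / b := by ring
    rw [this]
    field_simp
  rw [← hI, ← Set.compl_Iic, probReal_compl_eq_one_sub measurableSet_Iic]
  ring

/-- The probability that `d + Lap(8 / ε) ≤ θ`. -/
def removalProb (ε d θ : ℝ) : ℝ := (laplace (8 / ε)).real {ν : ℝ | d + ν ≤ θ}

/-- The two branches of the Laplace distribution function, in the shape in which the machine
evaluates them; `0 - x` appears because its expressions have no negation. -/
theorem removalProb_eq {ε : ℝ} (hε : 0 < ε) (d θ : ℝ) :
    removalProb ε d θ = if (θ - d) * ε / 8 ≤ 0 then Real.exp ((θ - d) * ε / 8) / 2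
      else 1 - Real.exp (0 - (θ - d) * ε / 8) / 2 := by
  have hset : {ν : ℝ | d + ν ≤ θ} = Set.Iic (θ - d) := by
    ext ν; simp [le_sub_iff_add_le']
  have hb : 0 < 8 / ε := by positivity
  have hx : (θ - d) / (8 / ε) = (θ - d) * ε / 8 := by field_simp
  have hx' : -(θ - d) / (8 / ε) = 0 - (θ - d) * ε / 8 := by field_simp; ring
  have hsgn : θ - d ≤ 0 ↔ (θ - d) * ε / 8 ≤ 0 := by
    rw [← hx, div_nonpos_iff]
    constructor
    · exact fun h => Or.inr ⟨h, hb.le⟩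
    · rintro (h | h)
      · linarith [h.2]
      · exact h.1
  rw [removalProb, hset]
  split_ifs with h
  · rw [laplace_real_Iic_of_nonpos hb (hsgn.2 h), hx]
  · rw [laplace_real_Iic_of_nonneg hb (le_of_lt (not_le.1 fun h' => h (hsgn.1 h'))), hx']

/-- Keeps `geom` away from its conventional value at `0`, where it would not be a waiting time. -/
theorem removalProb_pos {ε : ℝ} (hε : 0 < ε) (d θ : ℝ) : 0 < removalProb ε d θ := by
  rw [removalProb_eq hε]
  split_ifs with h
  · positivity
  · have : Real.exp (0 - (θ - d) * ε / 8) ≤ 1 := Real.exp_le_one_iff.2 (by linarith)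
    linarith

theorem removalProb_le_one {ε : ℝ} (hε : 0 < ε) (d θ : ℝ) : removalProb ε d θ ≤ 1 := by
  have := isProbabilityMeasure_laplace (b := 8 / ε) (by positivity)
  exact measureReal_le_one

theorem noisyTest_true {ε : ℝ} (hε : 0 < ε) (d θ : ℝ) :
    noisyTest ε hε d θ true = ENNReal.ofReal (removalProb ε d θ) := by
  have := isProbabilityMeasure_laplace (b := 8 / ε) (by positivity)
  rw [noisyTest, Measure.toPMF_apply, Measure.map_apply (measurable_noisyTest d θ) (by simp),
    removalProb, ofReal_measureReal]
  congr 1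
  ext ν; simp

theorem noisyTest_false {ε : ℝ} (hε : 0 < ε) (d θ : ℝ) :
    noisyTest ε hε d θ false = ENNReal.ofReal (1 - removalProb ε d θ) := by
  have h := (noisyTest ε hε d θ).tsum_coe
  rw [tsum_bool, noisyTest_true] at h
  rw [ENNReal.ofReal_sub _ (removalProb_pos hε d θ).le, ENNReal.ofReal_one, ← h,
    ENNReal.add_sub_cancel_right ENNReal.ofReal_ne_top]

theorem one_le_of_mem_support_geom {q : ℝ} {g : ℕ} (hg : g ∈ (geom q).support) : 1 ≤ g := by
  rw [geom, PMF.mem_support_map_iff] at hg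
  obtain ⟨j, _, rfl⟩ := hg
  omega

theorem geom_zero (q : ℝ) : geom q 0 = 0 := by
  rw [PMF.apply_eq_zero_iff]
  intro h
  simpa using one_le_of_mem_support_geom h

theorem geom_succ {q : ℝ} (h0 : 0 < q) (h1 : q ≤ 1) (j : ℕ) :
    geom q (j + 1) = ENNReal.ofReal ((1 - q) ^ j * q) := by
  rw [geom, PMF.map_apply, tsum_eq_single j (by intro i hi; rw [if_neg (by omega)]), if_pos rfl,
    Measure.toPMF_apply, Set.projIcc_of_mem zero_le_one ⟨h0.le, h1⟩, geometricMeasure_singleton]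
  intro h
  exact h0.ne' (congrArg Subtype.val h)

theorem map_succ_apply_zero (p : PMF ℕ) : (p.map (· + 1)) 0 = 0 := by
  rw [PMF.map_apply]; simp

theorem map_succ_apply_succ (p : PMF ℕ) (j : ℕ) : (p.map (· + 1)) (j + 1) = p j := by
  rw [PMF.map_apply, tsum_eq_single j (by intro i hi; rw [if_neg (by omega)]), if_pos rfl]

/-- A geometric waiting time, revealed for one trial. -/
theorem geom_removalProb_eq_bind {ε : ℝ} (hε : 0 < ε) (d θ : ℝ) :
    geom (removalProb ε d θ) = (noisyTest ε hε d θ).bind fun b =>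
      if b = true then PMF.pure 1 else (geom (removalProb ε d θ)).map (· + 1) := by
  have h0 := removalProb_pos hε d θ
  have h1 := removalProb_le_one hε d θ
  ext j
  rw [PMF.bind_apply, tsum_bool, noisyTest_true, noisyTest_false]
  simp only [Bool.false_eq_true, if_false, if_true]
  -- Time `0` is impossible, time `1` is an immediate success, and time `j + 2` is a failure
  -- followed by a waiting time `j + 1`.
  rcases j with _ | _ | j
  · rw [geom_zero, map_succ_apply_zero]; simp
  · rw [geom_succ h0 h1, map_succ_apply_succ, geom_zero]; simp
  · rw [geom_succ h0 h1, map_succ_apply_succ, geom_succ h0 h1, PMF.pure_apply_of_ne _ _ (by omega),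
      ← ENNReal.ofReal_mul (by linarith)]
    simp only [mul_zero, add_zero]
    congr 1; ring

/-! ### The naive loop -/

section Naive

variable {n : ℕ} (G : SimpleGraph (Fin n)) (ε : ℝ) (thr : Fin n → ℝ)

/-- The law of the waiting time of `v` up to its removal while the current set is `V`. -/
def waiting (V : Finset (Fin n)) (v : Fin n) : PMF ℕ :=
  geom (removalProb ε (indDeg G V v) (thr v))

theorem one_le_of_mem_support_waiting (V : Finset (Fin n)) (v : Fin n) :
    ∀ g ∈ (waiting G ε thr V v).support, 1 ≤ g :=
  fun _ hg => one_le_of_mem_support_geom hg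

theorem naiveBody_eq_peel (hε : 0 < ε) (V : Finset (Fin n)) :
    naiveBody G ε hε thr V =
      peel (fun v => noisyTest ε hε (indDeg G V v) (thr v)) (V.sort (· ≤ ·)) V := by
  rw [naiveBody]
  generalize V.sort (· ≤ ·) = l
  suffices ∀ W : Finset (Fin n), l.foldlM (init := W) (fun W v => do
      let b ← noisyTest ε hε (indDeg G V v) (thr v)
      pure (if b = true then W.erase v else W)) =
      peel (fun v => noisyTest ε hε (indDeg G V v) (thr v)) l W from this V
  induction l with
  | nil => intro W; rfl
  | cons v l ih =>
    intro W
    rw [List.foldlM_cons, bind_assoc]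
    simp only [pure_bind, ih]
    rfl

theorem subset_of_mem_support_naiveBody (hε : 0 < ε) (V : Finset (Fin n)) :
    ∀ V' ∈ (naiveBody G ε hε thr V).support, V' ⊆ V := by
  intro V' h
  rw [naiveBody_eq_peel] at h
  exact (peel_support h).1

/-- Independent geometric removal times of the current vertices, revealed for one round. -/
theorem sampSet_waiting_eq_naiveBody_bind (hε : 0 < ε) (V : Finset (Fin n)) (t : ℕ)
    (τ : Fin n → ℕ) :
    sampSet (waiting G ε thr V) t V τ = (naiveBody G ε hε thr V).bind fun V' =>
      sampSet (waiting G ε thr V) (t + 1) V' fun v => if v ∈ V ∧ v ∉ V' then t + 1 else τ v := by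
  rw [naiveBody_eq_peel]
  exact sampSet_eq_peel_bind (fun v => geom_removalProb_eq_bind hε _ _) t (V.sort_nodup _)
    (by simp) τ

end Naive

/-! ### The resampling loop -/

section Eff

variable {n : ℕ} (G : SimpleGraph (Fin n)) (ε : ℝ) (thr : Fin n → ℝ)

/-! ### Buckets and the first half of a round -/

/-- The buckets agree with the removal times for all future rounds, except possibly for missing
entries of vertices in `D`. -/
def BucketsOk (s : EffState n) (D : Fin n → Prop) : Prop :=
  (∀ v x, s.t < x → v ∈ s.toRemove x → s.removeTime v = x) ∧
    ∀ v, ¬ D v → s.t < s.removeTime v → v ∈ s.toRemove (s.removeTime v)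

/-- The state after `v` has been given the waiting time `g`. -/
def setTime (s : EffState n) (v : Fin n) (g : ℕ) : EffState n :=
  let old := Function.update s.toRemove (s.removeTime v) ((s.toRemove (s.removeTime v)).erase v)
  { s with
    toRemove := Function.update old (s.t + g) (insert v (old (s.t + g)))
    removeTime := Function.update s.removeTime v (s.t + g)
    work := s.work + 1 }

theorem resample_eq (s : EffState n) (v : Fin n) :
    resample G ε thr s v = (waiting G ε thr s.V v).bind fun g => PMF.pure (setTime s v g) := rfl

theorem foldlM_resample_cons (s : EffState n) (v : Fin n) (l : List (Fin n)) :
    (v :: l).foldlM (resample G ε thr) s = (waiting G ε thr s.V v).bind fun g =>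
      l.foldlM (resample G ε thr) (setTime s v g) := by
  rw [List.foldlM_cons, resample_eq]
  change (PMF.bind _ _).bind _ = _
  simp only [PMF.bind_bind, PMF.pure_bind]

theorem foldlM_resample_map_removeTime (l : List (Fin n)) (s : EffState n) :
    (l.foldlM (resample G ε thr) s).map EffState.removeTime =
      samp (waiting G ε thr s.V) s.t l s.removeTime := by
  induction l generalizing s with
  | nil => exact PMF.pure_map _ _
  | cons v l ih =>
    rw [foldlM_resample_cons, PMF.map_bind]
    simp only [ih]
    rfl

/-- A future occurrence of `v` can only be in the bucket of its old removal time, from which it is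
erased before being inserted anew. Hence `v` no longer needs the exemption, and the other vertices
are unaffected. -/
theorem BucketsOk.setTime {s : EffState n} {v : Fin n} {l : List (Fin n)}
    (h : BucketsOk s (· ∈ v :: l)) (g : ℕ) : BucketsOk (setTime s v g) (· ∈ l) := by
  obtain ⟨h₁, h₂⟩ := h
  have hne : ∀ w x, w ≠ v → (w ∈ (Peeling.setTime s v g).toRemove x ↔ w ∈ s.toRemove x) := by
    intro w x hw
    simp only [Peeling.setTime, Function.update_apply]
    split_ifs <;> simp_all
  have hv : ∀ x, s.t < x → v ∈ (Peeling.setTime s v g).toRemove x → x = s.t + g := by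
    intro x hx hvx
    by_contra hne
    simp only [Peeling.setTime, Function.update_apply, if_neg hne] at hvx
    split_ifs at hvx with h
    · simp at hvx
    · exact h (h₁ v x hx hvx).symm
  refine ⟨fun w x hx hw => ?_, fun w hw hx => ?_⟩
  · by_cases hwv : w = v
    · subst hwv
      rw [hv x hx hw]; simp [Peeling.setTime]
    · rw [hne w x hwv] at hw
      simpa [Peeling.setTime, hwv] using h₁ w x hx hw
  · by_cases hwv : w = v
    · subst hwv
      simp [Peeling.setTime]
    · have hr : (Peeling.setTime s v g).removeTime w = s.removeTime w := by
        simp [Peeling.setTime, hwv]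
      rw [hne w _ hwv, hr]
      rw [hr] at hx
      exact h₂ w (by simp [hwv, hw]) hx

theorem foldlM_resample_support {l : List (Fin n)} {s s' : EffState n}
    (h : s' ∈ (l.foldlM (resample G ε thr) s).support) (hs : BucketsOk s (· ∈ l)) :
    s'.t = s.t ∧ s'.V = s.V ∧ s'.work = s.work + l.length ∧
      (∀ v, v ∉ l → s'.removeTime v = s.removeTime v) ∧ BucketsOk s' fun _ => False := by
  induction l generalizing s with
  | nil =>
    have h : s' ∈ (PMF.pure s).support := h
    simp only [PMF.support_pure, Set.mem_singleton_iff] at h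
    subst h
    exact ⟨rfl, rfl, rfl, fun _ _ => rfl, by simpa using hs⟩
  | cons v l ih =>
    rw [foldlM_resample_cons, PMF.mem_support_bind_iff] at h
    obtain ⟨g, _, h⟩ := h
    obtain ⟨h₁, h₂, h₃, h₄, h₅⟩ := ih h (hs.setTime g)
    refine ⟨h₁, h₂, ?_, fun w hw => ?_, h₅⟩
    · rw [h₃]; simp [setTime]; ring
    · simp only [List.mem_cons, not_or] at hw
      rw [h₄ w hw.2]; simp [setTime, hw.1]

/-! ### Removals and the second half of a round -/

/-- The vertices that have to be resampled after the vertices of a list have been removed. -/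
def touched : List (Fin n) → Finset (Fin n) → Finset (Fin n) → Finset (Fin n)
  | [], _, U => U
  | v :: r, V, U => touched r (V.erase v) (U ∪ nbrsIn G (V.erase v) v)

theorem mem_nbrsIn {S : Finset (Fin n)} {v w : Fin n} : w ∈ nbrsIn G S v ↔ w ∈ S ∧ G.Adj v w := by
  simp [nbrsIn]

theorem subset_touched (r : List (Fin n)) (V U : Finset (Fin n)) : U ⊆ touched G r V U := by
  induction r generalizing V U with
  | nil => exact subset_rfl
  | cons v r ih => exact Finset.subset_union_left.trans (ih _ _)

theorem touched_subset (r : List (Fin n)) (V U : Finset (Fin n)) :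
    touched G r V U ⊆ U ∪ V := by
  induction r generalizing V U with
  | nil => exact Finset.subset_union_left
  | cons v r ih =>
    intro w hw
    have := ih _ _ hw
    simp only [Finset.mem_union, mem_nbrsIn, Finset.mem_erase] at this ⊢
    tauto

/-- What correctness needs: a survivor that is not touched has lost no neighbour. `touched` may
contain more, namely vertices of `r` reached from a neighbour processed before them. -/
theorem mem_touched {r : List (Fin n)} {V U : Finset (Fin n)} {v w : Fin n} (hv : v ∈ r)
    (hw : w ∈ V) (hwr : w ∉ r) (h : G.Adj v w) : w ∈ touched G r V U := by
  induction r generalizing V U with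
  | nil => simp at hv
  | cons x r ih =>
    simp only [List.mem_cons, not_or] at hwr
    rw [touched]
    rcases List.mem_cons.1 hv with rfl | hv
    · refine subset_touched G _ _ _ (Finset.mem_union_right _ ?_)
      simp [mem_nbrsIn, hw, hwr.1, h]
    · exact ih hv (by simp [hw, hwr.1]) hwr.2

theorem indDeg_mono {S T : Finset (Fin n)} (h : S ⊆ T) (v : Fin n) : indDeg G S v ≤ indDeg G T v :=
  Finset.card_le_card fun w hw => by
    rw [mem_nbrsIn] at hw ⊢
    exact ⟨h hw.1, hw.2⟩

theorem card_touched_le (r : List (Fin n)) (V U : Finset (Fin n)) :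
    (touched G r V U).card ≤ U.card + (r.map (indDeg G Finset.univ)).sum := by
  induction r generalizing V U with
  | nil => simp [touched]
  | cons v r ih =>
    have h₁ := ih (V.erase v) (U ∪ nbrsIn G (V.erase v) v)
    have h₂ := Finset.card_union_le U (nbrsIn G (V.erase v) v)
    have h₃ : (nbrsIn G (V.erase v) v).card ≤ indDeg G Finset.univ v :=
      indDeg_mono G (Finset.subset_univ _) v
    simp only [touched, List.map_cons, List.sum_cons]
    omega

theorem foldl_removeVertex (r : List (Fin n)) (s : EffState n) :
    r.foldl (removeVertex G) s = { s with
      V := s.V \ r.toFinset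
      updated := touched G r s.V s.updated
      work := s.work + (r.map fun v => 1 + indDeg G Finset.univ v).sum } := by
  induction r generalizing s with
  | nil => simp [touched]
  | cons v r ih =>
    rw [List.foldl_cons, ih]
    simp only [removeVertex, touched, List.toFinset_cons, List.map_cons, List.sum_cons,
      EffState.mk.injEq, true_and]
    refine ⟨?_, ?_⟩
    · ext w; simp; tauto
    · ring

/-- The second half of a round: the removals of round `s.t + 1`. -/
def finishRound (s : EffState n) : EffState n :=
  let s₂ : EffState n := { s with t := s.t + 1, updated := ∅, work := s.work + 1 }
  ((s₂.toRemove s₂.t).sort (· ≤ ·)).foldl (removeVertex G) s₂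

theorem effBody_eq (s : EffState n) :
    effBody G ε thr s = ((s.updated.sort (· ≤ ·)).foldlM (resample G ε thr) s).bind fun s₁ =>
      PMF.pure (finishRound G s₁) := rfl

/-- The vertices whose removal time is `x`. -/
def due (τ : Fin n → ℕ) (x : ℕ) : Finset (Fin n) := Finset.univ.filter fun v => τ v = x

theorem mem_due {τ : Fin n → ℕ} {x : ℕ} {v : Fin n} : v ∈ due τ x ↔ τ v = x := by simp [due]

/-- From here on the buckets can be forgotten: a round is determined by the removal times. -/
theorem BucketsOk.toRemove_eq {s : EffState n} (h : BucketsOk s fun _ => False) :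
    s.toRemove (s.t + 1) = due s.removeTime (s.t + 1) := by
  ext v
  rw [mem_due]
  refine ⟨h.1 v _ (by omega), fun hv => ?_⟩
  rw [← hv]
  exact h.2 v id (by omega)

theorem finishRound_eq {s : EffState n} (h : BucketsOk s fun _ => False) :
    finishRound G s = { s with
      t := s.t + 1
      V := s.V \ due s.removeTime (s.t + 1)
      updated := touched G ((due s.removeTime (s.t + 1)).sort (· ≤ ·)) s.V ∅
      work := s.work + 1 +
        ∑ v ∈ due s.removeTime (s.t + 1), (1 + indDeg G Finset.univ v) } := by
  rw [finishRound, foldl_removeVertex]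
  simp only [h.toRemove_eq, Finset.sort_toFinset, EffState.mk.injEq, true_and]
  rw [← Finset.sum_map_toList]
  exact congrArg _ (((Finset.sort_perm_toList _ _).map _).sum_eq)

/-- Only buckets of later rounds matter, and the removals do not change them; this is why processed
buckets need not be emptied. -/
theorem BucketsOk.finishRound {s : EffState n} (h : BucketsOk s fun _ => False)
    (D : Fin n → Prop) : BucketsOk (finishRound G s) D := by
  rw [finishRound_eq G h]
  exact ⟨fun v x hx => h.1 v x (by simp only at hx; omega),
    fun v _ hx => h.2 v id (by simp only at hx; omega)⟩

theorem subset_of_mem_support_effBody (s : EffState n) :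
    ∀ s' ∈ (effBody G ε thr s).support, s'.V ⊆ s.V := by
  intro s' h
  rw [effBody_eq, PMF.mem_support_bind_iff] at h
  obtain ⟨s₁, hs₁, h⟩ := h
  simp only [PMF.support_pure, Set.mem_singleton_iff] at h
  have key : ∀ (l : List (Fin n)) (s : EffState n),
      s₁ ∈ (l.foldlM (resample G ε thr) s).support → s₁.V = s.V := by
    intro l
    induction l with
    | nil =>
      intro s h
      have h : s₁ ∈ (PMF.pure s).support := h
      simp only [PMF.support_pure, Set.mem_singleton_iff] at h
      rw [h]
    | cons v l ih =>
      intro s h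
      rw [foldlM_resample_cons, PMF.mem_support_bind_iff] at h
      obtain ⟨g, _, h⟩ := h
      rw [ih _ h]; rfl
  rw [h, finishRound, foldl_removeVertex]
  simp only
  rw [key _ _ hs₁]
  exact Finset.sdiff_subset

/-! #### The law of the observations -/

/-- The law of the observations of `k` more rounds, from round `t` with current set `V`, removal
times `τ`, and vertices `U` to be resampled. -/
def effObs : ℕ → ℕ → Finset (Fin n) → (Fin n → ℕ) → Finset (Fin n) → List (Finset (Fin n)) →
    PMF (List (Finset (Fin n)) × Bool)
  | 0, _, _, _, _, tr => PMF.pure (tr, false)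
  | k + 1, t, V, τ, U, tr =>
    (samp (waiting G ε thr V) t (U.sort (· ≤ ·)) τ).bind fun τ₁ =>
      if V \ (V \ due τ₁ (t + 1)) = ∅ then PMF.pure (tr ++ [V \ due τ₁ (t + 1)], true)
      else effObs k (t + 1) (V \ due τ₁ (t + 1)) τ₁
        (touched G ((due τ₁ (t + 1)).sort (· ≤ ·)) V ∅) (tr ++ [V \ due τ₁ (t + 1)])

/-- The observations depend on the state only through the round, the current set, the removal times
and `updated`. -/
theorem loopFrom_effBody_observe (k : ℕ) (s : EffState n) (hs : BucketsOk s (· ∈ s.updated))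
    (tr : List (Finset (Fin n))) :
    (loopFrom (effBody G ε thr) EffState.V k ⟨s, tr, false⟩).map LoopCfg.observe =
      effObs G ε thr k s.t s.V s.removeTime s.updated tr := by
  induction k generalizing s tr with
  | zero => exact PMF.pure_map _ _
  | succ k ih =>
    rw [loopFrom_succ, effBody_eq, PMF.bind_bind, PMF.map_bind, effObs,
      ← foldlM_resample_map_removeTime, PMF.bind_map]
    refine pmf_bind_congr _ fun s₁ hs₁ => ?_
    obtain ⟨h₁, h₂, -, -, h₅⟩ := foldlM_resample_support G ε thr hs₁ (by simpa using hs)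
    have ht : (finishRound G s₁).t = s.t + 1 := by rw [finishRound_eq G h₅, h₁]
    have hV : (finishRound G s₁).V = s.V \ due s₁.removeTime (s.t + 1) := by
      rw [finishRound_eq G h₅, h₁, h₂]
    have hU : (finishRound G s₁).updated =
        touched G ((due s₁.removeTime (s.t + 1)).sort (· ≤ ·)) s.V ∅ := by
      rw [finishRound_eq G h₅, h₁, h₂]
    have hR : (finishRound G s₁).removeTime = s₁.removeTime := by rw [finishRound_eq G h₅]
    simp only [PMF.pure_bind, Function.comp_def]
    rw [hV]
    split_ifs with he
    · rw [loopFrom_of_done _ _ _ (by simpa using he), PMF.pure_map]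
      simp [LoopCfg.observe, he]
    · simp only [he, decide_false]
      rw [ih _ (h₅.finishRound G _), ht, hV, hU, hR]

theorem indDeg_eq_of_forall_not_adj {V V' : Finset (Fin n)} (hV : V' ⊆ V) {v : Fin n}
    (h : ∀ w ∈ V, w ∉ V' → ¬ G.Adj v w) : indDeg G V v = indDeg G V' v := by
  refine congrArg Finset.card ?_
  ext w
  simp only [mem_nbrsIn]
  constructor
  · rintro ⟨h₁, h₂⟩
    exact ⟨by_contra fun h' => h w h₁ h' h₂, h₂⟩
  · rintro ⟨h₁, h₂⟩
    exact ⟨hV h₁, h₂⟩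

/-- If the current vertices that are not to be resampled have independent geometric removal
times, the resampling loop looks like the naive one. -/
theorem sampSet_bind_effObs (hε : 0 < ε) (k t : ℕ) (V U : Finset (Fin n)) (p : Fin n → PMF ℕ)
    (hp : ∀ v ∈ V, v ∉ U → p v = waiting G ε thr V v) (τ : Fin n → ℕ)
    (tr : List (Finset (Fin n))) :
    ((sampSet p t V τ).bind fun τ' => effObs G ε thr k t V τ' U tr) =
      (loopFrom (naiveBody G ε hε thr) id k ⟨V, tr, false⟩).map LoopCfg.observe := by
  induction k generalizing t V U p τ tr with
  | zero => simp only [effObs, PMF.bind_const, loopFrom, PMF.pure_map, LoopCfg.observe]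
  | succ k ih =>
    obtain ⟨bg, hbg⟩ := sampSet_bind_samp p (waiting G ε thr V) t V (U.sort (· ≤ ·))
    simp only [effObs]
    rw [← PMF.bind_bind, hbg, PMF.bind_bind]
    -- The law of what follows will be the same for every background, so the background integrates
    -- out.
    refine Eq.trans ?_ (PMF.bind_const (bg τ) _)
    congr 1
    funext τ
    rw [sampSet_congr t (p' := waiting G ε thr V) (by
        intro v hv
        by_cases hvU : v ∈ U
        · simp [hvU]
        · simpa [hvU] using hp v hv hvU),
      sampSet_waiting_eq_naiveBody_bind G ε thr hε, PMF.bind_bind, loopFrom_succ, PMF.map_bind]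
    refine pmf_bind_congr _ fun V' hV' => ?_
    have hsub := subset_of_mem_support_naiveBody G ε thr hε V V' hV'
    set τ₀ : Fin n → ℕ := fun v => if v ∈ V ∧ v ∉ V' then t + 1 else τ v with hτ₀
    -- The vertices due in this round. Besides those of `V \ V'` they may include vertices removed
    -- earlier that were resampled once more; survivors have later times, so `R` is not random.
    set R := Finset.univ.filter fun v => v ∉ V' ∧ τ₀ v = t + 1 with hR
    have hdue : ∀ τ₁ ∈ (sampSet (waiting G ε thr V) (t + 1) V' τ₀).support,
        due τ₁ (t + 1) = R := by
      intro τ₁ hτ₁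
      obtain ⟨h₁, h₂⟩ := sampSet_support (one_le_of_mem_support_waiting G ε thr V) _ hτ₁
      ext v
      simp only [mem_due, hR, Finset.mem_filter, Finset.mem_univ, true_and]
      by_cases hv : v ∈ V'
      · have := h₂ v hv
        simp only [hv, not_true_eq_false, false_and, iff_false]
        omega
      · simp [hv, h₁ v hv]
    have hVR : V \ R = V' := by
      ext v
      simp only [hR, hτ₀, Finset.mem_sdiff, Finset.mem_filter, Finset.mem_univ, true_and]
      constructor
      · rintro ⟨h₁, h₂⟩
        by_contra h₃
        exact h₂ ⟨h₃, by simp [h₁, h₃]⟩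
      · exact fun h => ⟨hsub h, fun h' => h'.1 h⟩
    rw [pmf_bind_congr _ fun τ₁ hτ₁ => by rw [hdue τ₁ hτ₁, hVR]]
    simp only [id]
    split_ifs with he
    · rw [PMF.bind_const, loopFrom_of_done _ _ _ (by simpa using he), PMF.pure_map]
      simp [LoopCfg.observe, he]
    · simp only [he, decide_false]
      refine ih _ _ _ _ ?_ _ _
      -- An untouched survivor has the same degree in `V` and `V'`, so its waiting time already has
      -- the right law.
      intro v hv hvt
      rw [waiting, waiting, indDeg_eq_of_forall_not_adj G hsub]
      intro w hw hw' hadj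
      refine hvt (mem_touched G (v := w) ?_ (hsub hv) ?_ hadj.symm)
      · simp [hR, hτ₀, hw, hw']
      · simp [hR, hv]

/-- The initial constant times are a degenerate case of independent times. Their law is wrong, but
every vertex is marked for resampling, so the invariant holds at the start. -/
theorem sampSet_pure_const (m : ℕ) (S : Finset (Fin n)) :
    sampSet (fun _ => PMF.pure m) 0 S (fun _ => m) = PMF.pure fun _ => m := by
  rw [sampSet]
  induction S.toList with
  | nil => rfl
  | cons v l ih => rw [samp, PMF.pure_bind, zero_add, Function.update_eq_self_iff.2 rfl, ih]

theorem effRun_observe_eq (hε : 0 < ε) (k : ℕ) :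
    (effRun G ε thr k).map LoopCfg.observe = (naiveRun G ε hε thr k).map LoopCfg.observe := by
  rw [effRun, naiveRun, loopRun_eq_loopFrom, loopRun_eq_loopFrom, loopFrom_effBody_observe]
  · have h := sampSet_bind_effObs G ε thr hε k 0 Finset.univ Finset.univ (fun _ => PMF.pure n)
      (by simp) (fun _ => n) [Finset.univ]
    rw [sampSet_pure_const, PMF.pure_bind] at h
    exact h
  · exact ⟨by simp [EffState.start], by simp [EffState.start]⟩

/-! #### The amount of work -/

/-- How many more times `v` can be taken from a bucket. -/
def credit (s : EffState n) (v : Fin n) : ℕ :=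
  if v ∈ s.V then 2 else if v ∈ s.updated ∨ s.t < s.removeTime v then 1 else 0

/-- The right-hand side is a potential. Taking `v` from a bucket costs `1 + d(v)` and puts at most
`d(v)` vertices into `updated`, each costing one resampling: hence the weight `1 + 2 * d(v)`. A
vertex of `V` has credit `2` because a neighbour processed before it in the round of its removal can
mark it, so that it is scheduled once more; after that it is out of `V` and never marked again. The
summand `k` pays for the rounds. -/
theorem work_le_of_mem_support_loopFrom (k : ℕ) (s : EffState n)
    (hs : BucketsOk s (· ∈ s.updated)) (tr : List (Finset (Fin n))) (d : Bool) :
    ∀ c ∈ (loopFrom (effBody G ε thr) EffState.V k ⟨s, tr, d⟩).support,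
      c.state.work ≤ s.work + s.updated.card +
        ∑ v, credit s v * (1 + 2 * indDeg G Finset.univ v) + k := by
  induction k generalizing s tr d with
  | zero =>
    intro c hc
    simp only [loopFrom, PMF.support_pure, Set.mem_singleton_iff] at hc
    subst hc
    simp only
    omega
  | succ k ih =>
    intro c hc
    cases d
    swap
    · rw [loopFrom_of_done _ _ _ rfl] at hc
      simp only [PMF.support_pure, Set.mem_singleton_iff] at hc
      subst hc
      simp only
      omega
    rw [loopFrom_succ, effBody_eq, PMF.bind_bind, PMF.mem_support_bind_iff] at hc
    obtain ⟨s₁, hs₁, hc⟩ := hc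
    rw [PMF.pure_bind] at hc
    obtain ⟨h₁, h₂, h₃, h₄, h₅⟩ := foldlM_resample_support G ε thr hs₁ (by simpa using hs)
    refine (ih _ (h₅.finishRound G _) _ _ c hc).trans ?_
    have hcard := card_touched_le G ((due s₁.removeTime (s₁.t + 1)).sort (· ≤ ·)) s₁.V ∅
    rw [((Finset.sort_perm_toList _ _).map _).sum_eq, Finset.sum_map_toList] at hcard
    have hcredit : ∀ v, credit (finishRound G s₁) v +
        (if v ∈ due s₁.removeTime (s₁.t + 1) then 1 else 0) ≤ credit s v := by
      intro v
      have hsub := touched_subset G ((due s₁.removeTime (s₁.t + 1)).sort (· ≤ ·)) s₁.V ∅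
      rw [finishRound_eq G h₅]
      simp only [credit, mem_due, Finset.mem_sdiff]
      have ht : v ∈ touched G ((due s₁.removeTime (s₁.t + 1)).sort (· ≤ ·)) s₁.V ∅ → v ∈ s.V := by
        intro h
        simpa [h₂] using hsub h
      have h₄' := h₄ v
      rw [Finset.mem_sort] at h₄'
      rw [h₂, h₁] at *
      by_cases hvV : v ∈ s.V
      · simp only [hvV, true_and, if_true]
        split_ifs <;> omega
      · have hnt := mt ht hvV
        simp only [hvV, false_and, if_false, hnt, false_or]
        by_cases hU : v ∈ s.updated
        · simp only [hU, true_or, if_true]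
          split_ifs <;> omega
        · rw [h₄' hU]
          simp only [hU, false_or]
          split_ifs <;> omega
    have hsum : ∑ v, credit (finishRound G s₁) v * (1 + 2 * indDeg G Finset.univ v) +
        ∑ v ∈ due s₁.removeTime (s₁.t + 1), (1 + 2 * indDeg G Finset.univ v) ≤
        ∑ v, credit s v * (1 + 2 * indDeg G Finset.univ v) := by
      have : ∑ v ∈ due s₁.removeTime (s₁.t + 1), (1 + 2 * indDeg G Finset.univ v) =
          ∑ v, (if v ∈ due s₁.removeTime (s₁.t + 1) then 1 else 0) *
            (1 + 2 * indDeg G Finset.univ v) := by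
        simp [ite_mul, Finset.sum_ite_mem]
      rw [this, ← Finset.sum_add_distrib]
      refine Finset.sum_le_sum fun v _ => ?_
      rw [← add_mul]
      exact Nat.mul_le_mul_right _ (hcredit v)
    have hwork : (finishRound G s₁).work = s.work + s.updated.card + 1 +
        ∑ v ∈ due s₁.removeTime (s₁.t + 1), (1 + indDeg G Finset.univ v) := by
      rw [finishRound_eq G h₅]
      simp only [h₃, Finset.length_sort]
    have hupd : (finishRound G s₁).updated.card ≤
        ∑ v ∈ due s₁.removeTime (s₁.t + 1), indDeg G Finset.univ v := by
      rw [finishRound_eq G h₅]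
      simpa using hcard
    have hsplit : ∑ v ∈ due s₁.removeTime (s₁.t + 1), (1 + 2 * indDeg G Finset.univ v) =
        ∑ v ∈ due s₁.removeTime (s₁.t + 1), (1 + indDeg G Finset.univ v) +
        ∑ v ∈ due s₁.removeTime (s₁.t + 1), indDeg G Finset.univ v := by
      rw [← Finset.sum_add_distrib]
      exact Finset.sum_congr rfl fun v _ => by ring
    omega

theorem sum_indDeg_univ : ∑ v, indDeg G Finset.univ v = 2 * G.edgeSet.ncard := by
  classical
  have h := G.sum_degrees_eq_twice_card_edges
  rw [Set.ncard_eq_toFinset_card', ← SimpleGraph.edgeFinset, ← h]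
  refine Finset.sum_congr rfl fun v _ => ?_
  rw [indDeg, ← SimpleGraph.card_neighborFinset_eq_degree]
  congr 1
  ext w
  simp [mem_nbrsIn]

theorem work_le_of_mem_support_effRun :
    ∀ c ∈ (effRun G ε thr (n + 1)).support, c.state.work ≤ 8 * (n + G.edgeSet.ncard + 1) := by
  intro c hc
  rw [effRun, loopRun_eq_loopFrom] at hc
  have h := work_le_of_mem_support_loopFrom G ε thr (n + 1) (EffState.start n)
    ⟨by simp [EffState.start], by simp [EffState.start]⟩ _ _ c hc
  have hsum : ∑ v, credit (EffState.start n) v * (1 + 2 * indDeg G Finset.univ v) =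
      2 * (n + 4 * G.edgeSet.ncard) := by
    have : ∀ v, credit (EffState.start n) v * (1 + 2 * indDeg G Finset.univ v) =
        2 + 4 * indDeg G Finset.univ v := by
      intro v; simp [credit, EffState.start]; ring
    simp only [this, Finset.sum_add_distrib, ← Finset.mul_sum, sum_indDeg_univ]
    simp
    ring
  rw [hsum] at h
  simp only [EffState.start, Finset.card_univ, Fintype.card_fin] at h
  omega

end Eff

/-! ### A loop that only resamples surviving neighbours of removed vertices -/

section Canonical

variable {n : ℕ} (G : SimpleGraph (Fin n)) (ε : ℝ) (thr : Fin n → ℝ)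

/-- The vertices of `S` with a neighbour in `R`. -/
def exposed (S R : Finset (Fin n)) : Finset (Fin n) :=
  open Classical in S.filter fun w => ∃ v ∈ R, G.Adj v w

theorem mem_exposed {S R : Finset (Fin n)} {w : Fin n} :
    w ∈ exposed G S R ↔ w ∈ S ∧ ∃ v ∈ R, G.Adj v w := by
  simp [exposed]

/-- The law of the trace of `k` more rounds, from round `t` with current set `V` and removal
times `τ`, if exactly the surviving neighbours of removed vertices are resampled. -/
def lazyTrace : ℕ → ℕ → Finset (Fin n) → (Fin n → ℕ) → List (Finset (Fin n)) →
    PMF (List (Finset (Fin n)))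
  | 0, _, _, _, tr => PMF.pure tr
  | k + 1, t, V, τ, tr =>
    if V \ (V \ due τ (t + 1)) = ∅ then PMF.pure (tr ++ [V \ due τ (t + 1)])
    else (sampSet (waiting G ε thr (V \ due τ (t + 1))) (t + 1)
        (exposed G (V \ due τ (t + 1)) (V \ (V \ due τ (t + 1)))) τ).bind fun τ' =>
      lazyTrace k (t + 1) (V \ due τ (t + 1)) τ' (tr ++ [V \ due τ (t + 1)])

/-- Here all current vertices have waiting times of the right law at the start of each round, since
redrawing takes place at the end of the previous one. Reveal one naive round; survivors without a
removed neighbour keep their degree, and the exposed ones get the new law. -/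
theorem sampSet_bind_lazyTrace (hε : 0 < ε) (k t : ℕ) (V : Finset (Fin n)) (τ : Fin n → ℕ)
    (tr : List (Finset (Fin n))) :
    ((sampSet (waiting G ε thr V) t V τ).bind fun τ' => lazyTrace G ε thr k t V τ' tr) =
      (loopFrom (naiveBody G ε hε thr) id k ⟨V, tr, false⟩).map LoopCfg.trace := by
  induction k generalizing t V τ tr with
  | zero => simp only [lazyTrace, PMF.bind_const, loopFrom, PMF.pure_map]
  | succ k ih =>
    rw [sampSet_waiting_eq_naiveBody_bind G ε thr hε, PMF.bind_bind, loopFrom_succ, PMF.map_bind]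
    refine pmf_bind_congr _ fun V' hV' => ?_
    have hsub := subset_of_mem_support_naiveBody G ε thr hε V V' hV'
    set τ₀ : Fin n → ℕ := fun v => if v ∈ V ∧ v ∉ V' then t + 1 else τ v with hτ₀
    have hdue : ∀ τ₁ ∈ (sampSet (waiting G ε thr V) (t + 1) V' τ₀).support,
        V \ due τ₁ (t + 1) = V' := by
      intro τ₁ hτ₁
      obtain ⟨h₁, h₂⟩ := sampSet_support (one_le_of_mem_support_waiting G ε thr V) _ hτ₁
      ext v
      simp only [Finset.mem_sdiff, mem_due]
      by_cases hv : v ∈ V'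
      · have := h₂ v hv
        simp only [hv, hsub hv, true_and, iff_true]
        omega
      · rw [h₁ v hv]
        simp only [hτ₀, hv, iff_false, not_and, not_not]
        intro h
        simp [h]
    simp only [lazyTrace]
    rw [pmf_bind_congr _ fun τ₁ hτ₁ => by rw [hdue τ₁ hτ₁]]
    simp only [id]
    split_ifs with he
    · rw [PMF.bind_const, loopFrom_of_done _ _ _ (by simpa using he), PMF.pure_map]
    · simp only [he, decide_false]
      obtain ⟨bg, hbg⟩ := sampSet_bind_samp (waiting G ε thr V) (waiting G ε thr V') (t + 1) V'
        (exposed G V' (V \ V')).toList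
      rw [← PMF.bind_bind]
      -- Unfolding `sampSet` on the exposed set to a list draw brings the term into the form of
      -- `hbg`.
      change (PMF.bind _ (samp _ _ _)).bind _ = _
      rw [hbg, PMF.bind_bind]
      refine Eq.trans ?_ (PMF.bind_const (bg τ₀) _)
      congr 1
      funext τ
      rw [← ih (t + 1) V' τ]
      congr 1
      refine sampSet_congr _ (fun v hv => ?_) τ
      simp only [Finset.mem_toList]
      split_ifs with hvE
      · rfl
      · rw [waiting, waiting, indDeg_eq_of_forall_not_adj G hsub]
        intro w hw hw' hadj
        exact hvE ((mem_exposed G).2 ⟨hv, w, by simp [hw, hw'], hadj.symm⟩)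

end Canonical

/-! ### Program logic for the machine -/

section Logic

variable {n : ℕ}

/-- From the configuration `p`, the machine halts within `B` steps, with an output of law `ν`. -/
def Outputs (n : ℕ) (p : List Cmd × Store) (B : ℕ)
    (ν : PMF (Option (List (Finset (Fin n))))) : Prop :=
  ∀ T, B ≤ T → (runFor p T).map (outputTrace n) = ν

/-- Allows symbolic execution from the front of the command list, which all rules below perform. -/
theorem runFor_succ_first (p : List Cmd × Store) (T : ℕ) :
    runFor p (T + 1) = (step p).bind fun p' => runFor p' T := by
  induction T with
  | zero =>
    change (PMF.pure p).bind step = (step p).bind PMF.pure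
    rw [PMF.pure_bind, PMF.bind_pure]
  | succ T ih =>
    change (runFor p (T + 1)).bind step = (step p).bind fun p' => (runFor p' T).bind step
    rw [ih, PMF.bind_bind]

variable {K : List Cmd} {σ : Store} {B : ℕ} {ν : PMF (Option (List (Finset (Fin n))))}

theorem Outputs.mono {p : List Cmd × Store} {B' : ℕ} (h : Outputs n p B ν) (hB : B ≤ B') :
    Outputs n p B' ν := fun T hT => h T (hB.trans hT)

theorem Outputs.step {p p' : List Cmd × Store} (hp : step p = PMF.pure p')
    (h : Outputs n p' B ν) : Outputs n p (B + 1) ν := by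
  intro T hT
  obtain ⟨T, rfl⟩ : ∃ T', T = T' + 1 := ⟨T - 1, by omega⟩
  rw [runFor_succ_first, hp, PMF.pure_bind]
  exact h T (by omega)

theorem Outputs.halt (B : ℕ) (σ : Store) :
    Outputs n ([], σ) B (PMF.pure (outputTrace n ([], σ))) := by
  intro T _
  have : ∀ T, runFor ([], σ) T = PMF.pure ([], σ) := by
    intro T
    induction T with
    | zero => rfl
    | succ T ih => rw [runFor_succ_first, Peeling.step]; exact (PMF.pure_bind _ _).trans ih
  rw [this, PMF.pure_map]

theorem Outputs.skip (h : Outputs n (K, σ) B ν) : Outputs n (.skip :: K, σ) (B + 1) ν :=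
  h.step rfl

theorem Outputs.setNat {x : ℕ} {e : NExp} (h : Outputs n (K, σ.setNat x (e.eval σ)) B ν) :
    Outputs n (.setNat x e :: K, σ) (B + 1) ν := h.step rfl

theorem Outputs.putNat {a : ℕ} {i e : NExp}
    (h : Outputs n (K, σ.putNat a (i.eval σ) (e.eval σ)) B ν) :
    Outputs n (.putNat a i e :: K, σ) (B + 1) ν := h.step rfl

theorem Outputs.setReal {x : ℕ} {e : RExp} (h : Outputs n (K, σ.setReal x (e.eval σ)) B ν) :
    Outputs n (.setReal x e :: K, σ) (B + 1) ν := h.step rfl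

theorem Outputs.seq {c d : Cmd} (h : Outputs n (c :: d :: K, σ) B ν) :
    Outputs n (.seq c d :: K, σ) (B + 1) ν := h.step rfl

theorem Outputs.ite {b : BExp} {c d : Cmd} (h₁ : b.holds σ → Outputs n (c :: K, σ) B ν)
    (h₂ : ¬ b.holds σ → Outputs n (d :: K, σ) B ν) :
    Outputs n (.ite b c d :: K, σ) (B + 1) ν := by
  by_cases hb : b.holds σ
  · exact (h₁ hb).step (by rw [Peeling.step, if_pos hb]; rfl)
  · exact (h₂ hb).step (by rw [Peeling.step, if_neg hb]; rfl)

theorem Outputs.while_true {b : BExp} {c : Cmd} (hb : b.holds σ)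
    (h : Outputs n (c :: .while b c :: K, σ) B ν) :
    Outputs n (.while b c :: K, σ) (B + 1) ν :=
  h.step (by rw [Peeling.step, if_pos hb]; rfl)

theorem Outputs.while_false {b : BExp} {c : Cmd} (hb : ¬ b.holds σ) (h : Outputs n (K, σ) B ν) :
    Outputs n (.while b c :: K, σ) (B + 1) ν :=
  h.step (by rw [Peeling.step, if_neg hb]; rfl)

/-- The step bound has to be uniform in the sample `g`; outcomes outside the support may be ignored,
which supplies `1 ≤ g`. -/
theorem Outputs.sampleGeom {x : ℕ} {q : RExp} {ν : ℕ → PMF (Option (List (Finset (Fin n))))}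
    (h : ∀ g, 1 ≤ g → Outputs n (K, σ.setNat x g) B (ν g)) :
    Outputs n (.sampleGeom x q :: K, σ) (B + 1) ((geom (q.eval σ)).bind ν) := by
  intro T hT
  obtain ⟨T, rfl⟩ : ∃ T', T = T' + 1 := ⟨T - 1, by omega⟩
  have hs : Peeling.step (.sampleGeom x q :: K, σ) =
      (geom (q.eval σ)).bind fun g => PMF.pure (K, σ.setNat x g) := rfl
  rw [runFor_succ_first, hs, PMF.bind_bind, PMF.map_bind]
  refine pmf_bind_congr _ fun g hg => ?_
  rw [PMF.pure_bind]
  exact h g (one_le_of_mem_support_geom hg) T (by omega)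

end Logic

/-! ### The program

Natural registers: `0` holds `n`, `1` the round, `2` the vertex being removed, `3` a node of a
bucket, `4` a position in an adjacency list, `5` the vertex being resampled, `6` a new removal
time, `7` the number of nodes, `8` whether a vertex has been removed in this round.
Natural arrays: `0` and `1` hold the graph, `2` the rounds in which vertices were removed, `3` the
scheduled removal times, `4` the degrees, `5` the first node of each bucket, `6` the successor of
each node, `7` the vertex of each node. Nodes are numbered from `1`; they are never deleted, but a
node that no longer agrees with the removal time of its vertex is ignored. -/

/-- Compute in real register `2` the removal probability of the vertex in register `5`. -/
def probCmd : Cmd :=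
  .seq (.setReal 1 (.div (.mul (.sub (.get 0 (.reg 5)) (.ofNat (.get 4 (.reg 5)))) (.reg 0))
    (.ofNat (.const 8))))
  (.ite (.realLe (.reg 1) (.ofNat (.const 0)))
    (.setReal 2 (.div (.exp (.reg 1)) (.ofNat (.const 2))))
    (.setReal 2 (.sub (.ofNat (.const 1))
      (.div (.exp (.sub (.ofNat (.const 0)) (.reg 1))) (.ofNat (.const 2))))))

/-- Draw a new removal time for the vertex in register `5`, and put it into its bucket. -/
def scheduleCmd : Cmd :=
  .seq probCmd <|
  .seq (.sampleGeom 6 (.reg 2)) <|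
  .seq (.setNat 6 (.add (.reg 1) (.reg 6))) <|
  .seq (.putNat 3 (.reg 5) (.reg 6)) <|
  .seq (.setNat 7 (.add (.reg 7) (.const 1))) <|
  .seq (.putNat 7 (.reg 7) (.reg 5)) <|
  .seq (.putNat 6 (.reg 7) (.get 5 (.reg 6))) <|
  .putNat 5 (.reg 6) (.reg 7)

def initLoop : Cmd :=
  .while (.not (.natLe (.reg 0) (.reg 5))) <|
  .seq (.putNat 4 (.reg 5) (.sub (.get 0 (.add (.reg 5) (.const 1))) (.get 0 (.reg 5)))) <|
  .seq scheduleCmd <|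
  .setNat 5 (.add (.reg 5) (.const 1))

/-- Go through the neighbours of the vertex in register `2`, and update those not yet due. -/
def scanLoop : Cmd :=
  .while (.not (.natLe (.get 0 (.add (.reg 2) (.const 1))) (.reg 4))) <|
  .seq (.setNat 5 (.get 1 (.reg 4))) <|
  .seq (.ite (.natLe (.get 3 (.reg 5)) (.reg 1)) .skip
    (.seq (.putNat 4 (.reg 5) (.sub (.get 4 (.reg 5)) (.const 1))) scheduleCmd)) <|
  .setNat 4 (.add (.reg 4) (.const 1))

/-- Remove the vertex in register `2`. -/
def visitCmd : Cmd :=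
  .seq (.putNat 2 (.reg 2) (.reg 1)) <|
  .seq (.setNat 8 (.const 1)) <|
  .seq (.setNat 4 (.get 0 (.reg 2))) scanLoop

/-- The first two tests reject stale nodes. The third rejects a vertex already removed: it can occur
twice in the same bucket when two of its draws gave the same time. -/
def bucketLoop : Cmd :=
  .while (.natLe (.const 1) (.reg 3)) <|
  .seq (.setNat 2 (.get 7 (.reg 3))) <|
  .seq (.ite (.and (.and (.natLe (.get 3 (.reg 2)) (.reg 1)) (.natLe (.reg 1) (.get 3 (.reg 2))))
      (.natLe (.get 2 (.reg 2)) (.const 0))) visitCmd .skip) <|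
  .setNat 3 (.get 6 (.reg 3))

def mainLoop : Cmd :=
  .while (.natLe (.const 1) (.reg 8)) <|
  .seq (.setNat 8 (.const 0)) <|
  .seq (.setNat 1 (.add (.reg 1) (.const 1))) <|
  .seq (.setNat 3 (.get 5 (.reg 1))) bucketLoop

def program : Cmd :=
  .seq initLoop (.seq (.setNat 8 (.const 1)) mainLoop)

/-! ### Representation of the state in memory -/

section Correctness

variable {n : ℕ} {G : SimpleGraph (Fin n)} {ε : ℝ} {thr : Fin n → ℝ} {nbrs : Fin n → List (Fin n)}

/-- The first node of bucket `x`, if the entries `H` have been put into buckets, the latest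
entry first. -/
def firstNode (x : ℕ) : List (ℕ × Fin n) → ℕ
  | [] => 0
  | e :: H => if e.1 = x then H.length + 1 else firstNode x H

/-- The entries `H` are stored as linked lists. -/
def NodesOk (next vert : ℕ → ℕ) : List (ℕ × Fin n) → Prop
  | [] => True
  | e :: H => vert (H.length + 1) = e.2 ∧ next (H.length + 1) = firstNode e.1 H ∧
      NodesOk next vert H

theorem NodesOk.congr {next vert next' vert' : ℕ → ℕ} {H : List (ℕ × Fin n)}
    (h : NodesOk next vert H) (hn : ∀ i ≤ H.length, next' i = next i)
    (hv : ∀ i ≤ H.length, vert' i = vert i) : NodesOk next' vert' H := by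
  induction H with
  | nil => trivial
  | cons e H ih =>
    refine ⟨?_, ?_, ih h.2.2 (fun i hi => hn i ?_) fun i hi => hv i ?_⟩
    · rw [hv _ (by simp)]; exact h.1
    · rw [hn _ (by simp)]; exact h.2.1
    · simp only [List.length_cons]; omega
    · simp only [List.length_cons]; omega

/-- A node corresponds to the suffix of `H` that ended with its insertion, so a traversal position
is a suffix `Q`, and pushing new entries does not disturb it. -/
theorem NodesOk.of_suffix {next vert : ℕ → ℕ} {H Q : List (ℕ × Fin n)}
    (h : NodesOk next vert H) (hQ : Q <:+ H) : NodesOk next vert Q := by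
  induction H with
  | nil => rw [List.suffix_nil.1 hQ]; trivial
  | cons e H ih =>
    rcases List.suffix_cons_iff.1 hQ with rfl | hQ
    · exact h
    · exact ih h.2.2 hQ

/-- The number of entries for rounds after round `t`. -/
def pending (t : ℕ) (H : List (ℕ × Fin n)) : ℕ := H.countP fun e => decide (t < e.1)

/-- The memory represents the round `t`, the scheduled removal times `τ`, the rounds `out` of the
removals so far, the degrees `deg`, and the entries `H`. -/
structure Rep (nbrs : Fin n → List (Fin n)) (ε : ℝ) (thr : Fin n → ℝ) (σ : Store) (t : ℕ)
    (τ out deg : Fin n → ℕ) (H : List (ℕ × Fin n)) : Prop where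
  size : σ.natReg 0 = n
  round : σ.natReg 1 = t
  count : σ.natReg 7 = H.length
  starts : σ.natArr 0 = (inputStore nbrs ε thr).natArr 0
  lists : σ.natArr 1 = (inputStore nbrs ε thr).natArr 1
  eps : σ.realReg 0 = ε
  thresholds : ∀ v : Fin n, σ.realArr 0 v = thr v
  out : ∀ v : Fin n, σ.natArr 2 v = out v
  times : ∀ v : Fin n, σ.natArr 3 v = τ v
  deg : ∀ v : Fin n, σ.natArr 4 v = deg v
  first : ∀ x, σ.natArr 5 x = firstNode x H
  nodes : NodesOk (σ.natArr 6) (σ.natArr 7) H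

theorem Rep.setNat {σ : Store} {t : ℕ} {τ out deg : Fin n → ℕ} {H : List (ℕ × Fin n)}
    (h : Rep nbrs ε thr σ t τ out deg H) {x : ℕ} (hx : x ≠ 0 ∧ x ≠ 1 ∧ x ≠ 7) (y : ℕ) :
    Rep nbrs ε thr (σ.setNat x y) t τ out deg H := by
  refine { h with size := ?_, round := ?_, count := ?_ }
  · simpa [Store.setNat, hx.1.symm] using h.size
  · simpa [Store.setNat, hx.2.1.symm] using h.round
  · simpa [Store.setNat, hx.2.2.symm] using h.count

theorem Rep.setReal {σ : Store} {t : ℕ} {τ out deg : Fin n → ℕ} {H : List (ℕ × Fin n)}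
    (h : Rep nbrs ε thr σ t τ out deg H) {x : ℕ} (hx : x ≠ 0) (y : ℝ) :
    Rep nbrs ε thr (σ.setReal x y) t τ out deg H := by
  refine { h with eps := ?_ }
  simpa [Store.setReal, hx.symm] using h.eps

theorem update_val_apply (f : ℕ → ℕ) {f' : Fin n → ℕ} (h : ∀ v : Fin n, f v = f' v) (w : Fin n)
    (y : ℕ) (v : Fin n) : Function.update f w y v = Function.update f' w y v := by
  by_cases hv : v = w
  · subst hv; simp
  · rw [Function.update_of_ne hv, Function.update_of_ne (fun h' => hv (Fin.ext h')), h]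

theorem Rep.putOut {σ : Store} {t : ℕ} {τ out deg : Fin n → ℕ} {H : List (ℕ × Fin n)}
    (h : Rep nbrs ε thr σ t τ out deg H) (w : Fin n) (y : ℕ) :
    Rep nbrs ε thr (σ.putNat 2 w y) t τ (Function.update out w y) deg H :=
  { h with out := by simpa [Store.putNat] using update_val_apply _ h.out w y }

theorem Rep.putDeg {σ : Store} {t : ℕ} {τ out deg : Fin n → ℕ} {H : List (ℕ × Fin n)}
    (h : Rep nbrs ε thr σ t τ out deg H) (w : Fin n) (y : ℕ) :
    Rep nbrs ε thr (σ.putNat 4 w y) t τ out (Function.update deg w y) H :=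
  { h with deg := by simpa [Store.putNat] using update_val_apply _ h.deg w y }

/-- Storing a new removal time `x` of `w`, together with a new entry. -/
theorem Rep.push {σ : Store} {t : ℕ} {τ out deg : Fin n → ℕ} {H : List (ℕ × Fin n)}
    (h : Rep nbrs ε thr σ t τ out deg H) (w : Fin n) (x : ℕ) :
    Rep nbrs ε thr (((((σ.putNat 3 w x).setNat 7 (H.length + 1)).putNat 7 (H.length + 1) w).putNat 6
      (H.length + 1) (firstNode x H)).putNat 5 x (H.length + 1))
      t (Function.update τ w x) out deg ((x, w) :: H) := by
  refine { h with size := h.size, round := h.round, count := rfl, times := ?_, first := ?_, nodes := ?_ }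
  · simpa [Store.putNat, Store.setNat] using update_val_apply _ h.times w x
  · intro y
    by_cases hy : y = x
    · subst hy; simp [Store.putNat, Store.setNat, firstNode]
    · simpa [Store.putNat, Store.setNat, firstNode, hy, Ne.symm hy] using h.first y
  · refine ⟨by simp [Store.putNat, Store.setNat], by simp [Store.putNat, Store.setNat],
      h.nodes.congr (fun i hi => ?_) fun i hi => ?_⟩
    · simp [Store.putNat, Store.setNat, show i ≠ H.length + 1 by omega]
    · simp [Store.putNat, Store.setNat, show i ≠ H.length + 1 by omega]

theorem Outputs.probCmd (hε : 0 < ε) {K : List Cmd} {σ : Store} {B : ℕ}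
    {ν : PMF (Option (List (Finset (Fin n))))} {t : ℕ} {τ out deg : Fin n → ℕ}
    {H : List (ℕ × Fin n)} {w : Fin n} (h : Rep nbrs ε thr σ t τ out deg H)
    (hw : σ.natReg 5 = w)
    (hK : ∀ y, Outputs n (K, (σ.setReal 1 y).setReal 2 (removalProb ε (deg w) (thr w))) B ν) :
    Outputs n (Peeling.probCmd :: K, σ) (B + 4) ν := by
  refine Outputs.seq (Outputs.setReal ?_)
  have he : RExp.eval σ (.div (.mul (.sub (.get 0 (.reg 5)) (.ofNat (.get 4 (.reg 5)))) (.reg 0))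
      (.ofNat (.const 8))) = (thr w - deg w) * ε / 8 := by
    simp [RExp.eval, NExp.eval, hw, h.thresholds, h.deg, h.eps]
  rw [he]
  have hK := hK ((thr w - deg w) * ε / 8)
  rw [removalProb_eq hε] at hK
  refine Outputs.ite (fun hb => ?_) fun hb => ?_
  · have hb : (thr w - deg w) * ε / 8 ≤ 0 := by
      simpa [BExp.holds, RExp.eval, NExp.eval, Store.setReal] using hb
    rw [if_pos hb] at hK
    refine Outputs.setReal ?_
    simpa [RExp.eval, NExp.eval, Store.setReal] using hK
  · have hb : ¬ (thr w - deg w) * ε / 8 ≤ 0 := by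
      simpa [BExp.holds, RExp.eval, NExp.eval, Store.setReal] using hb
    rw [if_neg hb] at hK
    refine Outputs.setReal ?_
    simpa [RExp.eval, NExp.eval, Store.setReal] using hK

/-- The constant `18` counts four steps of `probCmd` and fourteen of the remaining commands,
including the sequencing steps. -/
theorem Outputs.scheduleCmd (hε : 0 < ε) {K : List Cmd} {σ : Store} {B : ℕ}
    {ν : ℕ → PMF (Option (List (Finset (Fin n))))} {t : ℕ} {τ out deg : Fin n → ℕ}
    {H : List (ℕ × Fin n)} {w : Fin n} (h : Rep nbrs ε thr σ t τ out deg H)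
    (hw : σ.natReg 5 = w)
    (hK : ∀ σ' g, 1 ≤ g → Rep nbrs ε thr σ' t (Function.update τ w (t + g)) out deg
        ((t + g, w) :: H) → (∀ x, x ≠ 6 → x ≠ 7 → σ'.natReg x = σ.natReg x) →
      Outputs n (K, σ') B (ν g)) :
    Outputs n (Peeling.scheduleCmd :: K, σ) (B + 18)
      ((geom (removalProb ε (deg w) (thr w))).bind ν) := by
  refine Outputs.seq (Outputs.probCmd hε h hw fun y => Outputs.seq ?_)
  set σ₁ := (σ.setReal 1 y).setReal 2 (removalProb ε (deg w) (thr w)) with hσ₁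
  have h₁ : Rep nbrs ε thr σ₁ t τ out deg H := (h.setReal (by simp) _).setReal (by simp) _
  have hq : RExp.eval σ₁ (.reg 2) = removalProb ε (deg w) (thr w) := by
    simp [hσ₁, RExp.eval, Store.setReal]
  rw [← hq]
  refine Outputs.sampleGeom fun g hg => ?_
  refine Outputs.seq (Outputs.setNat (Outputs.seq ?_))
  set σ₂ := (σ₁.setNat 6 g).setNat 6 (NExp.eval (σ₁.setNat 6 g) (.add (.reg 1) (.reg 6))) with hσ₂
  have h₂ : Rep nbrs ε thr σ₂ t τ out deg H := (h₁.setNat (by simp) _).setNat (by simp) _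
  have hr₂ : ∀ x, x ≠ 6 → σ₂.natReg x = σ.natReg x := by
    intro x hx
    simp [hσ₂, hσ₁, Store.setNat, Store.setReal, hx]
  have h6 : σ₂.natReg 6 = t + g := by
    have := h₁.round
    simp [hσ₂, Store.setNat, NExp.eval, this]
  have h5 : σ₂.natReg 5 = w := by rw [hr₂ 5 (by simp), hw]
  have h7 : σ₂.natReg 7 = H.length := h₂.count
  have hf : σ₂.natArr 5 (t + g) = firstNode (t + g) H := h₂.first _
  refine Outputs.putNat (Outputs.seq (Outputs.setNat (Outputs.seq (Outputs.putNat
    (Outputs.seq (Outputs.putNat (Outputs.putNat ?_)))))))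
  refine (congrArg (fun s => Outputs n (K, s) B (ν g)) ?_).mp
    (hK _ g hg (h₂.push w (t + g)) fun x h6 h7 => ?_)
  · simp [NExp.eval, Store.putNat, Store.setNat, h5, h6, h7, hf]
  · simpa [Store.putNat, Store.setNat, h7] using hr₂ x h6

/-! #### The input -/

/-- The position at which the adjacency list of vertex `i` starts. -/
def listStart (nbrs : Fin n → List (Fin n)) (i : ℕ) : ℕ :=
  ((List.ofFn nbrs).take i).flatten.length

theorem inputStore_starts {i : ℕ} (hi : i ≤ n) :
    (inputStore nbrs ε thr).natArr 0 i = listStart nbrs i := by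
  simp [inputStore, hi, listStart]

theorem take_ofFn_succ (v : Fin n) :
    (List.ofFn nbrs).take (v + 1) = (List.ofFn nbrs).take v ++ [nbrs v] := by
  rw [List.take_succ_eq_append_getElem (by simp)]
  simp

theorem listStart_succ (v : Fin n) :
    listStart nbrs (v + 1) = listStart nbrs v + (nbrs v).length := by
  rw [listStart, take_ofFn_succ]
  simp [listStart]

theorem inputStore_lists {v w : Fin n} {l L : List (Fin n)} (h : nbrs v = l ++ w :: L) :
    (inputStore nbrs ε thr).natArr 1 (listStart nbrs v + l.length) = w := by
  have hsplit : (List.ofFn nbrs).flatten = ((List.ofFn nbrs).take v).flatten ++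
      (l ++ (w :: (L ++ ((List.ofFn nbrs).drop (v + 1)).flatten))) := by
    conv_lhs => rw [← List.take_append_drop (v + 1) (List.ofFn nbrs), take_ofFn_succ]
    simp [h]
  simp only [inputStore, one_ne_zero, if_false, if_true]
  rw [hsplit, listStart]
  generalize ((List.ofFn nbrs).take v).flatten = A
  rw [List.getD_eq_getElem?_getD, List.getElem?_map, List.getElem?_append_right (by omega),
    List.getElem?_append_right (by omega)]
  simp

theorem length_nbrs (hadj : IsAdjacencyLists G nbrs) (v : Fin n) :
    (nbrs v).length = indDeg G Finset.univ v := by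
  rw [indDeg, ← List.toFinset_card_of_nodup (hadj v).1]
  congr 1
  ext w
  simp [mem_nbrsIn, (hadj v).2]

/-! #### Removing the vertices of a bucket -/

/-- The invariant within round `t`: `S` is the set of vertices that survive the round, `fin` gives
the removal rounds at its end, `R` are the vertices that are still to be removed in this round, and
`L` are the neighbours of the last removed vertex that are still to be looked at. -/
structure Mid (G : SimpleGraph (Fin n)) (nbrs : Fin n → List (Fin n)) (ε : ℝ) (thr : Fin n → ℝ)
    (t : ℕ) (S : Finset (Fin n)) (fin : Fin n → ℕ) (R : Finset (Fin n)) (L : List (Fin n))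
    (σ : Store) (τ deg : Fin n → ℕ) (H : List (ℕ × Fin n)) : Prop where
  rep : Rep nbrs ε thr σ t τ (fun v => if v ∈ R then 0 else fin v) deg H
  live : ∀ v, t < τ v ↔ v ∈ S
  due : ∀ v ∈ R, τ v = t
  sched : ∀ v ∈ S, (τ v, v) ∈ H
  deg : ∀ w ∈ S, deg w = indDeg G (S ∪ R) w + if w ∈ L then 1 else 0

variable {t : ℕ} {S R : Finset (Fin n)} {fin : Fin n → ℕ} {σ : Store} {τ deg : Fin n → ℕ}
  {H : List (ℕ × Fin n)} {K : List Cmd} {B : ℕ}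
  {N : (Fin n → ℕ) → PMF (Option (List (Finset (Fin n))))}

/-- If none of the vertices still to be removed is adjacent to `w`, its present degree is already
its degree at the end of the round, so a draw made now has the final law. -/
theorem waiting_eq_of_notMem_exposed {w : Fin n} (hw : w ∈ S) (h : w ∉ exposed G S R) :
    waiting G ε thr S w = geom (removalProb ε (indDeg G (S ∪ R) w) (thr w)) := by
  rw [waiting, indDeg_eq_of_forall_not_adj G (V := S ∪ R) Finset.subset_union_left]
  intro v hv hv' hadj
  exact h ((mem_exposed G).2 ⟨hw, v, by simpa [hv'] using hv, hadj.symm⟩)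

theorem holds_scanLoop_iff {out : Fin n → ℕ} {v : Fin n} {l L : List (Fin n)}
    (hrep : Rep nbrs ε thr σ t τ out deg H) (hl : nbrs v = l ++ L) (h2 : σ.natReg 2 = v)
    (h4 : σ.natReg 4 = listStart nbrs v + l.length) :
    BExp.holds σ (.not (.natLe (.get 0 (.add (.reg 2) (.const 1))) (.reg 4))) ↔ L ≠ [] := by
  simp only [BExp.holds, NExp.eval, h2, h4, hrep.starts,
    inputStore_starts (Nat.succ_le_of_lt v.2), listStart_succ, hl, List.length_append,
    ← List.length_pos_iff]
  omega

/-- The set in the law consists of the survivors that will be drawn again before the round ends: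
those in the rest of the list and those adjacent to vertices of `R`. The budget counts `8` for every
entry of a future bucket, prepaying its visit. An iteration costs `34`: at most `26` steps, and `8`
for the entry it may create. -/
theorem Outputs.scanLoop (hε : 0 < ε) {v : Fin n} (hnd : (nbrs v).Nodup)
    {H₀ : List (ℕ × Fin n)} {r₃ r₈ : ℕ}
    (hK : ∀ σ' τ' deg' H', Mid G nbrs ε thr t S fin R [] σ' τ' deg' H' → H₀ <:+ H' →
      σ'.natReg 3 = r₃ → σ'.natReg 8 = r₈ →
      Outputs n (K, σ') (B + 8 * pending t H')
        ((sampSet (waiting G ε thr S) t (exposed G S R) τ').bind N))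
    (L l : List (Fin n)) (hl : nbrs v = l ++ L) (hM : Mid G nbrs ε thr t S fin R L σ τ deg H)
    (hH : H₀ <:+ H) (h3 : σ.natReg 3 = r₃) (h8 : σ.natReg 8 = r₈) (h2 : σ.natReg 2 = v)
    (h4 : σ.natReg 4 = listStart nbrs v + l.length) :
    Outputs n (Peeling.scanLoop :: K, σ) (B + 8 * pending t H + 34 * L.length + 1)
      ((sampSet (waiting G ε thr S) t (exposed G S R ∪ (S.filter (· ∈ L))) τ).bind N) := by
  induction L generalizing l σ τ deg H with
  | nil =>
    refine Outputs.while_false (by simp [holds_scanLoop_iff hM.rep hl h2 h4]) ?_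
    have hS : exposed G S R ∪ S.filter (· ∈ ([] : List (Fin n))) = exposed G S R := by simp
    rw [hS]
    exact (hK _ _ _ _ hM hH h3 h8).mono (by simp)
  | cons w L ih =>
    have hwL : w ∉ L := by
      rw [hl, List.nodup_append] at hnd
      exact (List.nodup_cons.1 hnd.2.1).1
    have hl' : nbrs v = (l ++ [w]) ++ L := by rw [hl]; simp
    have hnext : ∀ {σ' τ' deg' H'}, Mid G nbrs ε thr t S fin R L σ' τ' deg' H' →
        H₀ <:+ H' → (∀ x, x ≠ 5 → x ≠ 6 → x ≠ 7 → σ'.natReg x = σ.natReg x) →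
        Outputs n (.setNat 4 (.add (.reg 4) (.const 1)) :: Peeling.scanLoop :: K, σ')
          (B + 8 * pending t H' + 34 * L.length + 2)
          ((sampSet (waiting G ε thr S) t (exposed G S R ∪ (S.filter (· ∈ L))) τ').bind N) := by
      intro σ' τ' deg' H' hM' hH' hr
      refine Outputs.setNat ?_
      have hM'' : Mid G nbrs ε thr t S fin R L
          (σ'.setNat 4 (NExp.eval σ' (.add (.reg 4) (.const 1)))) τ' deg' H' :=
        { hM' with rep := hM'.rep.setNat (by simp) _ }
      have h4' : (σ'.setNat 4 (NExp.eval σ' (.add (.reg 4) (.const 1)))).natReg 4 =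
          listStart nbrs v + (l ++ [w]).length := by
        simp [Store.setNat, NExp.eval, hr 4, h4]; ring
      have h2' : (σ'.setNat 4 (NExp.eval σ' (.add (.reg 4) (.const 1)))).natReg 2 = v := by
        simp [Store.setNat, hr 2, h2]
      refine ih _ hl' hM'' hH' ?_ ?_ h2' h4'
      · simp [Store.setNat, hr 3, h3]
      · simp [Store.setNat, hr 8, h8]
    refine Outputs.mono (B := B + 8 * pending t H + 34 * L.length + 8 + 27) ?_
      (by simp only [List.length_cons]; omega)
    refine Outputs.while_true ((holds_scanLoop_iff hM.rep hl h2 h4).2 (by simp))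
      (Outputs.seq (Outputs.setNat (Outputs.seq ?_)))
    have h5 : NExp.eval σ (.get 1 (.reg 4)) = w := by
      simp only [NExp.eval, h4, hM.rep.lists]
      exact inputStore_lists hl
    rw [h5]
    have hrep := hM.rep.setNat (x := 5) (by simp) (w : ℕ)
    have hw5 : (σ.setNat 5 w).natReg 5 = w := by simp [Store.setNat]
    have hcond' : BExp.holds (σ.setNat 5 w) (.natLe (.get 3 (.reg 5)) (.reg 1)) ↔ w ∉ S := by
      rw [← hM.live]
      simp only [BExp.holds, NExp.eval, hw5, hrep.times, hrep.round]
      omega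
    refine Outputs.ite (fun hb => ?_) fun hb => ?_
    · have hwS := hcond'.1 hb
      have hS : S.filter (· ∈ w :: L) = S.filter (· ∈ L) := by
        refine Finset.filter_congr fun u hu => ?_
        have : u ≠ w := by rintro rfl; exact hwS hu
        simp [this]
      rw [hS]
      refine Outputs.mono (B := B + 8 * pending t H + 34 * L.length + 3) ?_ (by omega)
      refine Outputs.skip (hnext { hM with rep := hrep, deg := fun u hu => ?_ } hH fun x h _ _ => ?_)
      · have : u ≠ w := by rintro rfl; exact hwS hu
        rw [hM.deg u hu]; simp [this]
      · simp [Store.setNat, h]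
    · have hwS : w ∈ S := not_not.1 (mt hcond'.2 hb)
      have hdeg : deg w - 1 = indDeg G (S ∪ R) w := by
        rw [hM.deg w hwS]; simp
      refine Outputs.seq (Outputs.putNat ?_)
      have he : NExp.eval (σ.setNat 5 w) (.sub (.get 4 (.reg 5)) (.const 1)) =
          indDeg G (S ∪ R) w := by
        simp only [NExp.eval, hw5, hrep.deg, hdeg]
      have hi : NExp.eval (σ.setNat 5 w) (.reg 5) = w := hw5
      rw [he, hi]
      have hrep' := hrep.putDeg w (indDeg G (S ∪ R) w)
      have hlaw : ((sampSet (waiting G ε thr S) t (exposed G S R ∪ S.filter (· ∈ w :: L)) τ).bind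
          N) = (geom (removalProb ε (Function.update deg w (indDeg G (S ∪ R) w) w)
            (thr w))).bind fun g => (sampSet (waiting G ε thr S) t
              (exposed G S R ∪ S.filter (· ∈ L)) (Function.update τ w (t + g))).bind N := by
        rw [Function.update_self]
        have hS : exposed G S R ∪ S.filter (· ∈ w :: L) =
            insert w (exposed G S R ∪ S.filter (· ∈ L)) := by
          ext u
          simp only [Finset.mem_union, Finset.mem_filter, List.mem_cons, Finset.mem_insert]
          constructor
          · tauto
          · rintro (rfl | h)
            · exact Or.inr ⟨hwS, Or.inl rfl⟩
            · tauto
        rw [hS]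
        -- If `w` will be drawn again this round, the present draw is overwritten and has no effect;
        -- otherwise it is the final draw of `w`, and its degree is final.
        by_cases hwE : w ∈ exposed G S R ∪ S.filter (· ∈ L)
        · rw [Finset.insert_eq_of_mem hwE]
          simp only [sampSet_update_of_mem _ _ hwE, PMF.bind_const]
        · rw [sampSet_insert _ _ hwE, PMF.bind_bind,
            waiting_eq_of_notMem_exposed (R := R) hwS fun h =>
              hwE (Finset.mem_union_left _ h)]
      rw [hlaw]
      refine Outputs.mono (B := B + 8 * pending t H + 34 * L.length + 8 + 2 + 18) ?_ (by omega)
      refine Outputs.scheduleCmd hε hrep' (by simpa [Store.putNat] using hw5)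
        fun σ' g hg hrep'' hr => ?_
      have hp : pending t ((t + g, w) :: H) = pending t H + 1 := by
        rw [pending, List.countP_cons_of_pos (by simp; omega), pending]
      refine (hnext (H' := (t + g, w) :: H)
        { rep := hrep'', live := fun u => ?_, due := fun u hu => ?_, sched := fun u hu => ?_,
          deg := fun u hu => ?_ } (hH.trans (List.suffix_cons _ _)) fun x h5 h6 h7 => ?_).mono
          (by rw [hp]; omega)
      · by_cases huw : u = w
        · subst huw; simp [hwS]; omega
        · simpa [huw] using hM.live u
      · have huw : u ≠ w := by
          rintro rfl
          have := hM.due u hu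
          have := (hM.live u).2 hwS
          omega
        simpa [huw] using hM.due u hu
      · by_cases huw : u = w
        · subst huw; simp
        · simpa [huw] using hM.sched u hu
      · by_cases huw : u = w
        · subst huw; simp [hwL]
        · simpa [huw] using hM.deg u hu
      · rw [hr x h6 h7]; simp [Store.putNat, Store.setNat, h5]

theorem indDeg_union_erase (hadj : IsAdjacencyLists G nbrs) {v : Fin n} (hv : v ∈ R) (hvS : v ∉ S)
    (w : Fin n) :
    indDeg G (S ∪ R) w = indDeg G (S ∪ R.erase v) w + if w ∈ nbrs v then 1 else 0 := by
  rw [indDeg, indDeg]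
  split_ifs with h
  · have hvw : G.Adj v w := ((hadj v).2 w).1 h
    have : nbrsIn G (S ∪ R) w = insert v (nbrsIn G (S ∪ R.erase v) w) := by
      ext u
      simp only [mem_nbrsIn, Finset.mem_union, Finset.mem_insert, Finset.mem_erase]
      by_cases hu : u = v
      · subst hu; simp [hv, hvw.symm]
      · simp [hu]
    rw [this, Finset.card_insert_of_notMem (by simp [mem_nbrsIn, hvS])]
  · have hvw : ¬ G.Adj v w := fun h' => h (((hadj v).2 w).2 h')
    rw [add_zero]
    congr 1
    ext u
    simp only [mem_nbrsIn, Finset.mem_union, Finset.mem_erase]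
    by_cases hu : u = v
    · subst hu
      have : ¬ G.Adj w u := fun h' => hvw h'.symm
      simp [this]
    · simp [hu]

/-- Passes from the set due to be redrawn before `v` is removed to the form that `Outputs.scanLoop`
expects. -/
theorem exposed_erase_union (hadj : IsAdjacencyLists G nbrs) {v : Fin n} (hv : v ∈ R) :
    exposed G S (R.erase v) ∪ S.filter (· ∈ nbrs v) = exposed G S R := by
  ext u
  simp only [Finset.mem_union, mem_exposed, Finset.mem_filter, (hadj v).2, Finset.mem_erase]
  constructor
  · rintro (⟨h, x, ⟨_, hx⟩, hx'⟩ | ⟨h, h'⟩)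
    · exact ⟨h, x, hx, hx'⟩
    · exact ⟨h, v, hv, h'⟩
  · rintro ⟨h, x, hx, hx'⟩
    by_cases hxv : x = v
    · subst hxv; exact Or.inr ⟨h, hx'⟩
    · exact Or.inl ⟨h, x, ⟨hxv, hx⟩, hx'⟩

/-- Entries created during the traversal belong to later buckets, since waiting times are at least
`1`, so the chain `Q` being followed stays intact. Each node of the bucket costs at most `8` steps,
stale or not; an actual removal costs `8` more and its scan. `R₀` is the set to be removed in the
whole round, kept to interpret the flag in register `8`. -/
theorem Outputs.bucketLoop (hε : 0 < ε) (hadj : IsAdjacencyLists G nbrs) {R₀ : Finset (Fin n)}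
    (hfin : ∀ v, fin v = 0 ↔ v ∈ S) (hfin₀ : ∀ v ∈ R₀, fin v = t)
    (hK : ∀ σ' τ' deg' H', Mid G nbrs ε thr t S fin ∅ [] σ' τ' deg' H' →
      (σ'.natReg 8 = 0 ↔ R₀ = ∅) → Outputs n (K, σ') (B + 8 * pending t H') (N τ'))
    (Q : List (ℕ × Fin n)) (hM : Mid G nbrs ε thr t S fin R [] σ τ deg H) (hQ : Q <:+ H)
    (h3 : σ.natReg 3 = firstNode t Q) (hRQ : ∀ v ∈ R, (t, v) ∈ Q) (hR : R ⊆ R₀)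
    (h8 : σ.natReg 8 = 0 ↔ R = R₀) :
    Outputs n (Peeling.bucketLoop :: K, σ)
      (B + 8 * pending t H + 8 * Q.countP (fun e => decide (e.1 = t)) +
        ∑ v ∈ R, (8 + 34 * (nbrs v).length) + 1)
      ((sampSet (waiting G ε thr S) t (exposed G S R) τ).bind N) := by
  induction Q generalizing σ τ deg H R with
  | nil =>
    obtain rfl : R = ∅ := Finset.eq_empty_of_forall_notMem fun v hv => by simpa using hRQ v hv
    have hE : exposed G S ∅ = ∅ := by ext; simp [mem_exposed]
    rw [hE, sampSet_empty, PMF.pure_bind]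
    refine Outputs.while_false (by simp [BExp.holds, NExp.eval, h3, firstNode]) ?_
    exact (hK _ _ _ _ hM (h8.trans eq_comm)).mono (by simp)
  | cons e Q ih =>
    obtain ⟨x, v⟩ := e
    have hQ' : Q <:+ H := (List.suffix_cons _ _).trans hQ
    by_cases hx : x = t
    swap
    · rw [List.countP_cons_of_neg (by simpa using hx)]
      refine ih hM hQ' (by simpa [firstNode, hx] using h3) (fun u hu => ?_) hR h8
      have := hRQ u hu
      simpa [Ne.symm hx] using this
    subst hx
    rw [List.countP_cons_of_pos (by simp)]
    have h3' : σ.natReg 3 = Q.length + 1 := by simpa [firstNode] using h3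
    have hvert : σ.natArr 7 (Q.length + 1) = v := (hM.rep.nodes.of_suffix hQ).1
    have hnext : ∀ {σ' τ' deg' H' R'}, Mid G nbrs ε thr x S fin R' [] σ' τ' deg' H' → H <:+ H' →
        σ'.natReg 3 = Q.length + 1 → (∀ u ∈ R', (x, u) ∈ Q) → R' ⊆ R₀ →
        (σ'.natReg 8 = 0 ↔ R' = R₀) →
        Outputs n (.setNat 3 (.get 6 (.reg 3)) :: Peeling.bucketLoop :: K, σ')
          (B + 8 * pending x H' + 8 * Q.countP (fun e => decide (e.1 = x)) +
            ∑ v ∈ R', (8 + 34 * (nbrs v).length) + 2)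
          ((sampSet (waiting G ε thr S) x (exposed G S R') τ').bind N) := by
      intro σ' τ' deg' H' R' hM' hH' h3'' hRQ' hR' h8'
      refine Outputs.setNat ?_
      refine ih { hM' with rep := hM'.rep.setNat (by simp) _ } (hQ'.trans hH') ?_ hRQ' hR' ?_
      · have := (hM'.rep.nodes.of_suffix (hQ.trans hH')).2.1
        simpa [Store.setNat, NExp.eval, h3''] using this
      · simpa [Store.setNat] using h8'
    refine Outputs.mono (B := B + 8 * pending x H + 8 * Q.countP (fun e => decide (e.1 = x)) +
        ∑ v ∈ R, (8 + 34 * (nbrs v).length) + 3 + 5) ?_ (by omega)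
    refine Outputs.while_true (by simp [BExp.holds, NExp.eval, h3'])
      (Outputs.seq (Outputs.setNat (Outputs.seq ?_)))
    have hv : NExp.eval σ (.get 7 (.reg 3)) = v := by simp [NExp.eval, h3', hvert]
    rw [hv]
    have hM₁ : Mid G nbrs ε thr x S fin R [] (σ.setNat 2 v) τ deg H :=
      { hM with rep := hM.rep.setNat (by simp) _ }
    have hv2 : (σ.setNat 2 v).natReg 2 = v := by simp [Store.setNat]
    have hcond : BExp.holds (σ.setNat 2 v)
        (.and (.and (.natLe (.get 3 (.reg 2)) (.reg 1)) (.natLe (.reg 1) (.get 3 (.reg 2))))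
        (.natLe (.get 2 (.reg 2)) (.const 0))) ↔ v ∈ R := by
      simp only [BExp.holds, NExp.eval, hv2, hM₁.rep.times, hM₁.rep.round, hM₁.rep.out]
      constructor
      · rintro ⟨⟨h₁, h₂⟩, h₃⟩
        -- Outside `R`, a recorded round `0` means that `v` survives, hence that its time is later
        -- than `x`.
        by_contra hvR
        rw [if_neg hvR, Nat.le_zero, hfin, ← hM.live] at h₃
        omega
      · intro h
        rw [hM.due v h]
        simp [h]
    refine Outputs.ite (fun hb => ?_) fun hb => ?_
    · have hvR := hcond.1 hb
      have hvS : v ∉ S := by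
        rw [← hM.live, hM.due v hvR]; omega
      have hsum := Finset.sum_erase_add R (fun v => 8 + 34 * (nbrs v).length) hvR
      refine Outputs.mono (B := B + 8 * Q.countP (fun e => decide (e.1 = x)) +
        ∑ v ∈ R.erase v, (8 + 34 * (nbrs v).length) + 2 + 8 * pending x H +
        34 * (nbrs v).length + 1 + 6) ?_ (by omega)
      refine Outputs.seq (Outputs.putNat (Outputs.seq (Outputs.setNat (Outputs.seq
        (Outputs.setNat ?_)))))
      have hi : NExp.eval (σ.setNat 2 v) (.reg 2) = v := hv2
      have he : NExp.eval (σ.setNat 2 v) (.reg 1) = x := hM₁.rep.round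
      rw [hi, he]
      have hrep := ((hM₁.rep.putOut v x).setNat (x := 8) (by simp) 1).setNat (x := 4) (by simp)
        (listStart nbrs v)
      have hout : Function.update (fun u => if u ∈ R then 0 else fin u) v x =
          fun u => if u ∈ R.erase v then 0 else fin u := by
        funext u
        by_cases huv : u = v
        · subst huv; simp [hfin₀ u (hR hvR)]
        · simp [huv]
      rw [hout] at hrep
      have h4 : NExp.eval (((σ.setNat 2 v).putNat 2 v x).setNat 8
          (NExp.eval ((σ.setNat 2 v).putNat 2 v x) (.const 1))) (.get 0 (.reg 2)) =
          listStart nbrs v := by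
        have := hrep.starts
        rw [← inputStore_starts (ε := ε) (thr := thr) v.2.le, ← this]
        simp [NExp.eval, Store.setNat, Store.putNat]
      rw [h4, ← exposed_erase_union hadj hvR]
      refine Outputs.scanLoop hε (hadj v).1 (H₀ := H) (r₃ := Q.length + 1) (r₈ := 1)
        (fun σ' τ' deg' H' hM' hH' h3'' h8'' => ?_) (nbrs v) [] rfl
        { rep := hrep, live := hM.live, due := fun u hu => hM.due u (Finset.mem_of_mem_erase hu),
          sched := hM.sched, deg := fun w hw => ?_ } List.suffix_rfl ?_ ?_ ?_ ?_
      · refine (hnext hM' hH' h3'' (fun u hu => ?_) ((R.erase_subset v).trans hR) ?_).mono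
          (by omega)
        · have := hRQ u (Finset.mem_of_mem_erase hu)
          simpa [Finset.ne_of_mem_erase hu] using this
        · rw [h8'']
          simp only [one_ne_zero, false_iff]
          intro h
          have := hR hvR
          rw [← h] at this
          simp at this
      · have := hM.deg w hw
        rw [indDeg_union_erase hadj hvR hvS] at this
        simpa using this
      · simpa [Store.setNat, Store.putNat] using h3'
      · simp [Store.setNat, NExp.eval]
      · simp [Store.setNat, Store.putNat]
      · simp [Store.setNat]
    · have hvR := mt hcond.2 hb
      refine Outputs.skip (hnext hM₁ List.suffix_rfl ?_ (fun u hu => ?_) hR ?_)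
      · simpa [Store.setNat] using h3'
      · have := hRQ u hu
        have huv : u ≠ v := by rintro rfl; exact hvR hu
        simpa [huv] using this
      · simpa [Store.setNat] using h8

end Correctness

section Correctness

variable {n : ℕ} {G : SimpleGraph (Fin n)} {ε : ℝ} {thr : Fin n → ℝ} {nbrs : Fin n → List (Fin n)}

/-! #### Rounds -/

/-- The trace `[V_0, ..., V_t]` encoded by the rounds of the removals. -/
def traceOf (out : Fin n → ℕ) (t : ℕ) : List (Finset (Fin n)) :=
  (List.range (t + 1)).map fun s => Finset.univ.filter fun v => out v = 0 ∨ s < out v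

/-- The invariant after round `t`, with current set `V`. -/
structure Head (G : SimpleGraph (Fin n)) (nbrs : Fin n → List (Fin n)) (ε : ℝ) (thr : Fin n → ℝ)
    (t : ℕ) (V : Finset (Fin n)) (σ : Store) (τ out deg : Fin n → ℕ)
    (H : List (ℕ × Fin n)) : Prop where
  rep : Rep nbrs ε thr σ t τ out deg H
  live : ∀ v, t < τ v ↔ v ∈ V
  out_eq_zero : ∀ v, out v = 0 ↔ v ∈ V
  out_le : ∀ v, out v ≤ t
  sched : ∀ v ∈ V, (τ v, v) ∈ H
  deg : ∀ w ∈ V, deg w = indDeg G V w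

variable {t : ℕ} {V : Finset (Fin n)} {σ : Store} {τ out deg : Fin n → ℕ}
  {H : List (ℕ × Fin n)} {K : List Cmd} {B : ℕ}
  {N : (Fin n → ℕ) → PMF (Option (List (Finset (Fin n))))}

theorem outputTrace_of_rep (h : Rep nbrs ε thr σ t τ out deg H) :
    outputTrace n ([], σ) = some (traceOf out t) := by
  simp [outputTrace, traceOf, h.round, h.out]

/-- The prepayments of the entries that fall due are exactly what the traversal of bucket `t + 1`
consumes. -/
theorem pending_eq_add (t : ℕ) (H : List (ℕ × Fin n)) :
    pending t H = pending (t + 1) H + H.countP fun e => decide (e.1 = t + 1) := by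
  induction H with
  | nil => rfl
  | cons e H ih =>
    simp only [pending, List.countP_cons, decide_eq_true_eq] at ih ⊢
    rw [ih]
    split_ifs <;> omega

theorem Rep.setRound (h : Rep nbrs ε thr σ t τ out deg H) (t' : ℕ) :
    Rep nbrs ε thr (σ.setNat 1 t') t' τ out deg H :=
  { h with size := h.size, round := rfl, count := h.count }

/-- The condition `V.card < k` ensures that `lazyTrace` does not run out of rounds before the
machine stops. In the charge `16` per vertex, `8` goes to its removal and `8` to the overhead of a
round, since every round but the last removes a vertex; the `10` covers the last round. -/
theorem Outputs.mainLoop (hε : 0 < ε) (hadj : IsAdjacencyLists G nbrs) (k : ℕ)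
    (hk : V.card < k) (hH : Head G nbrs ε thr t V σ τ out deg H) (h8 : σ.natReg 8 ≠ 0) :
    Outputs n ([Peeling.mainLoop], σ)
      (8 * pending t H + ∑ v ∈ V, (16 + 34 * (nbrs v).length) + 10)
      ((lazyTrace G ε thr k t V τ (traceOf out t)).map some) := by
  induction k generalizing t V σ τ out deg H with
  | zero => omega
  | succ k ih =>
    set S := V \ due τ (t + 1) with hS
    set R := V \ S with hR
    have hmemR : ∀ v, v ∈ R ↔ v ∈ V ∧ τ v = t + 1 := by
      intro v
      simp only [hR, hS, Finset.mem_sdiff, mem_due]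
      tauto
    have hmemS : ∀ v, v ∈ S ↔ v ∈ V ∧ τ v ≠ t + 1 := by
      intro v; simp only [hS, Finset.mem_sdiff, mem_due]
    set fin : Fin n → ℕ := fun v => if v ∈ R then t + 1 else out v with hfin
    have hfin0 : ∀ v, fin v = 0 ↔ v ∈ S := by
      intro v
      simp only [hfin]
      split_ifs with h
      · rw [hmemR] at h
        rw [hmemS]
        simp [h.2]
      · rw [hH.out_eq_zero, hmemS]
        rw [hmemR] at h
        tauto
    have hfinle : ∀ v, fin v ≤ t + 1 := by
      intro v
      have := hH.out_le v
      simp only [hfin]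
      split_ifs <;> omega
    have htr : traceOf fin (t + 1) = traceOf out t ++ [S] := by
      rw [traceOf, List.range_succ, List.map_append, traceOf]
      congr 1
      · refine List.map_congr_left fun s hs => Finset.filter_congr fun v _ => ?_
        have hs := List.mem_range.1 hs
        simp only [hfin]
        split_ifs with h
        · have := (hH.out_eq_zero v).2 ((hmemR v).1 h).1
          simp [this, hs]
        · rfl
      · simp only [List.map_cons, List.map_nil, List.cons.injEq, and_true]
        ext v
        have := hfinle v
        simp [hfin0, not_lt.2 this]
    -- In the last round `lazyTrace` draws nothing, but a draw can be inserted because its result is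
    -- ignored there. This gives both cases the form required by `Outputs.bucketLoop`.
    have hlaw : (lazyTrace G ε thr (k + 1) t V τ (traceOf out t)).map some =
        (sampSet (waiting G ε thr S) (t + 1) (exposed G S R) τ).bind fun τ' =>
          if R = ∅ then PMF.pure (some (traceOf fin (t + 1)))
          else (lazyTrace G ε thr k (t + 1) S τ' (traceOf fin (t + 1))).map some := by
      rw [lazyTrace, ← hS, ← hR, htr]
      split_ifs with he
      · rw [PMF.pure_map, PMF.bind_const]
      · rw [PMF.map_bind]
    have hsum : ∑ v ∈ V, (16 + 34 * (nbrs v).length) = ∑ v ∈ S, (16 + 34 * (nbrs v).length) +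
        (∑ v ∈ R, (8 + 34 * (nbrs v).length) + 8 * R.card) := by
      rw [← Finset.sum_sdiff (Finset.sdiff_subset : R ⊆ V), hR,
        Finset.sdiff_sdiff_eq_self Finset.sdiff_subset, Finset.card_eq_sum_ones, Finset.mul_sum,
        ← Finset.sum_add_distrib]
      exact congrArg _ (Finset.sum_congr rfl fun v _ => by ring)
    rw [hlaw]
    -- Seven steps open the round. If nothing is removed, one more test leaves the loop; otherwise
    -- `10` is handed on to the next round, and `8 * R.card ≥ 8` pays for the present one.
    refine Outputs.mono (B := ∑ v ∈ S, (16 + 34 * (nbrs v).length) + (if R = ∅ then 1 else 10) +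
      8 * pending (t + 1) H + 8 * H.countP (fun e => decide (e.1 = t + 1)) +
      ∑ v ∈ R, (8 + 34 * (nbrs v).length) + 1 + 7) ?_ ?_
    swap
    · rw [pending_eq_add t H, hsum]
      split_ifs with he
      · omega
      · have := Finset.card_pos.2 (Finset.nonempty_iff_ne_empty.2 he)
        omega
    refine Outputs.while_true (by simp [BExp.holds, NExp.eval]; omega) (Outputs.seq
      (Outputs.setNat (Outputs.seq (Outputs.setNat (Outputs.seq (Outputs.setNat ?_))))))
    have he1 : NExp.eval (σ.setNat 8 (NExp.eval σ (.const 0))) (.add (.reg 1) (.const 1)) =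
        t + 1 := by
      simp [NExp.eval, Store.setNat, hH.rep.round]
    rw [he1]
    set σ₁ := (σ.setNat 8 (NExp.eval σ (.const 0))).setNat 1 (t + 1) with hσ₁
    have hrep : Rep nbrs ε thr σ₁ (t + 1) τ (fun v => if v ∈ R then 0 else fin v) deg H := by
      have hout : (fun v => if v ∈ R then 0 else fin v) = out := by
        funext v
        simp only [hfin]
        split_ifs with h
        · exact ((hH.out_eq_zero v).2 ((hmemR v).1 h).1).symm
        · rfl
      rw [hout]
      exact (hH.rep.setNat (by simp) _).setRound _
    have he3 : NExp.eval σ₁ (.get 5 (.reg 1)) = firstNode (t + 1) H := by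
      simp only [NExp.eval, hrep.round, hrep.first]
    rw [he3]
    refine Outputs.bucketLoop hε hadj (R₀ := R) hfin0 (fun v hv => by simp [hfin, hv])
      (fun σ' τ' deg' H' hM hflag => ?_) H
      { rep := hrep.setNat (by simp) _, live := fun v => ?_, due := fun v hv => ((hmemR v).1 hv).2,
        sched := fun v hv => hH.sched v ((hmemS v).1 hv).1, deg := fun w hw => ?_ }
      List.suffix_rfl (by simp [Store.setNat]) (fun v hv => ?_) subset_rfl ?_
    · have hrep' : Rep nbrs ε thr σ' (t + 1) τ' fin deg' H' := by simpa using hM.rep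
      split_ifs with he
      · refine Outputs.mono (B := 0 + 1) (Outputs.while_false ?_ ?_) (by omega)
        · simp [BExp.holds, NExp.eval, hflag.2 he]
        · have := Outputs.halt (n := n) 0 σ'
          rwa [outputTrace_of_rep hrep'] at this
      · have hcard : S.card < k := by
          have hSV : S ⊆ V := Finset.sdiff_subset
          have h := Finset.card_sdiff_add_card_eq_card hSV
          have := Finset.card_pos.2 (Finset.nonempty_iff_ne_empty.2 he)
          rw [← hR] at h
          omega
        refine (ih hcard ⟨hrep', hM.live, hfin0, hfinle, hM.sched, fun w hw => ?_⟩
          (mt hflag.1 he)).mono (by omega)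
        simpa using hM.deg w hw
    · rw [hmemS, ← hH.live]; omega
    · have : S ∪ R = V := by
        rw [hR]; exact Finset.union_sdiff_of_subset Finset.sdiff_subset
      rw [this]
      simpa using hH.deg w ((hmemS w).1 hw).1
    · have := (hmemR v).1 hv
      rw [← this.2]
      exact hH.sched v this.1
    · simp [hσ₁, Store.setNat, NExp.eval]

/-! #### Initialization -/

/-- The vertices from `i` on have not been drawn yet and form the set in the law; each takes `23`
steps, `18` of them for scheduling. -/
theorem Outputs.initLoop (hε : 0 < ε) (hadj : IsAdjacencyLists G nbrs)
    (hK : ∀ σ' τ' deg' H', Head G nbrs ε thr 0 Finset.univ σ' τ' (fun _ => 0) deg' H' →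
      H'.length = n → Outputs n (K, σ') B (N τ'))
    (j i : ℕ) (hij : i + j = n) (hrep : Rep nbrs ε thr σ 0 τ (fun _ => 0) deg H)
    (h5 : σ.natReg 5 = i) (hlen : H.length = i)
    (hdone : ∀ v : Fin n, v < i → 0 < τ v ∧ (τ v, v) ∈ H ∧ deg v = indDeg G Finset.univ v) :
    Outputs n (Peeling.initLoop :: K, σ) (B + 23 * j + 1)
      ((sampSet (waiting G ε thr Finset.univ) 0
        (Finset.univ.filter fun v : Fin n => i ≤ v) τ).bind N) := by
  induction j generalizing i σ τ deg H with
  | zero =>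
    have hE : (Finset.univ.filter fun v : Fin n => i ≤ v) = ∅ := by
      ext v; have := v.2; simp; omega
    rw [hE, sampSet_empty, PMF.pure_bind]
    refine Outputs.while_false (by simp [BExp.holds, NExp.eval, h5, hrep.size]; omega) ?_
    have hlt : ∀ v : Fin n, (v : ℕ) < i := fun v => by have := v.2; omega
    exact hK _ _ _ _ ⟨hrep, fun v => by simp [(hdone v (hlt v)).1], by simp, by simp,
      fun v _ => (hdone v (hlt v)).2.1, fun v _ => (hdone v (hlt v)).2.2⟩ (by omega)
  | succ j ih =>
    have hi : i < n := by omega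
    set w : Fin n := ⟨i, hi⟩ with hw
    have hE : (Finset.univ.filter fun v : Fin n => i ≤ v) =
        insert w (Finset.univ.filter fun v : Fin n => i + 1 ≤ v) := by
      ext v
      simp only [Finset.mem_filter, Finset.mem_univ, true_and, Finset.mem_insert, hw, Fin.ext_iff]
      omega
    rw [hE, sampSet_insert _ _ (by simp [hw]), PMF.bind_bind]
    refine Outputs.mono (B := B + 23 * j + 2 + 18 + 4) ?_ (by omega)
    refine Outputs.while_true (by simp [BExp.holds, NExp.eval, h5, hrep.size]; omega)
      (Outputs.seq (Outputs.putNat (Outputs.seq ?_)))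
    have he : NExp.eval σ (.sub (.get 0 (.add (.reg 5) (.const 1))) (.get 0 (.reg 5))) =
        indDeg G Finset.univ w := by
      simp only [NExp.eval, h5, hrep.starts, inputStore_starts (show i + 1 ≤ n from hi),
        inputStore_starts hi.le]
      have := listStart_succ (nbrs := nbrs) w
      simp only [hw] at this
      rw [← length_nbrs hadj]
      simp only [hw]
      omega
    have hi5 : NExp.eval σ (.reg 5) = w := h5
    rw [he, hi5]
    have hrep' := hrep.putDeg w (indDeg G Finset.univ w)
    have hlaw : waiting G ε thr Finset.univ w = geom (removalProb ε
        (Function.update deg w (indDeg G Finset.univ w) w) (thr w)) := by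
      rw [Function.update_self]; rfl
    rw [hlaw]
    refine Outputs.scheduleCmd hε hrep' h5 fun σ' g hg hrep'' hr => Outputs.setNat ?_
    refine ih (i + 1) (by omega) (hrep''.setNat (by simp) _) ?_ (by simp [hlen]) fun v hv => ?_
    · have := hr 5 (by simp) (by simp)
      simp only [Store.putNat] at this
      simp [Store.setNat, NExp.eval, this, h5]
    · by_cases hvw : v = w
      · rw [hvw]; simp; omega
      · have hvi : (v : ℕ) < i := by
          have : (v : ℕ) ≠ i := fun h => hvw (Fin.ext h)
          omega
        have := hdone v hvi
        simp only [ne_eq, hvw, not_false_eq_true, Function.update_of_ne, List.mem_cons]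
        exact ⟨this.1, Or.inr this.2.1, this.2.2⟩

theorem rep_inputStore : Rep nbrs ε thr (inputStore nbrs ε thr) 0 (fun _ => 0) (fun _ => 0)
    (fun _ => 0) [] where
  size := by simp [inputStore]
  round := by simp [inputStore]
  count := by simp [inputStore]
  starts := rfl
  lists := rfl
  eps := by simp [inputStore]
  thresholds := by simp [inputStore]
  out := by simp [inputStore]
  times := by simp [inputStore]
  deg := by simp [inputStore]
  first := by simp [inputStore, firstNode]
  nodes := trivial

theorem effRun_map_trace (hε : 0 < ε) (k : ℕ) :
    (effRun G ε thr k).map LoopCfg.trace = (naiveRun G ε hε thr k).map LoopCfg.trace := by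
  have h := congrArg (PMF.map Prod.fst) (effRun_observe_eq G ε thr hε k)
  rw [PMF.map_comp, PMF.map_comp] at h
  exact h

theorem outputs_program (hε : 0 < ε) (hadj : IsAdjacencyLists G nbrs) :
    Outputs n ([program], inputStore nbrs ε thr) (100 * (n + G.edgeSet.ncard + 1))
      ((effRun G ε thr (n + 1)).map fun c => some c.trace) := by
  have hlaw : ((effRun G ε thr (n + 1)).map fun c => some c.trace) =
      (sampSet (waiting G ε thr Finset.univ) 0
        (Finset.univ.filter fun v : Fin n => 0 ≤ (v : ℕ)) fun _ => 0).bind fun τ =>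
        (lazyTrace G ε thr (n + 1) 0 Finset.univ τ (traceOf (fun _ => 0) 0)).map some := by
    have h := sampSet_bind_lazyTrace G ε thr hε (n + 1) 0 Finset.univ (fun _ => 0) [Finset.univ]
    have htr : traceOf (fun _ : Fin n => 0) 0 = [Finset.univ] := by simp [traceOf]
    have hE : (Finset.univ.filter fun v : Fin n => 0 ≤ (v : ℕ)) = Finset.univ := by simp
    have hrun := effRun_map_trace (G := G) (thr := thr) hε (n + 1)
    rw [naiveRun, loopRun_eq_loopFrom] at hrun
    rw [← PMF.map_bind, htr, hE, h]
    change PMF.map (some ∘ LoopCfg.trace) _ = _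
    rw [← PMF.map_comp, hrun]
    rfl
  have hsum : ∑ v, (16 + 34 * (nbrs v).length) = 16 * n + 68 * G.edgeSet.ncard := by
    simp only [length_nbrs hadj, Finset.sum_add_distrib, ← Finset.mul_sum, sum_indDeg_univ]
    simp
    ring
  rw [hlaw]
  -- Here `24 * n` is `16 * n` from the charges per vertex plus `8 * n` for the `n` initial entries,
  -- and `68 = 34 * 2` because every edge lies in two adjacency lists.
  refine Outputs.mono (B := (24 * n + 68 * G.edgeSet.ncard + 10 + 2) + 23 * n + 1 + 1) ?_
    (by omega)
  refine Outputs.seq (Outputs.initLoop hε hadj (fun σ' τ' deg' H' hH hlen => ?_) n 0 (by simp)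
    rep_inputStore (by simp [inputStore]) rfl (by simp))
  refine Outputs.seq (Outputs.setNat ?_)
  refine (Outputs.mainLoop hε hadj (n + 1) (by simp)
    { hH with rep := hH.rep.setNat (by simp) _ } (by simp [Store.setNat, NExp.eval])).mono ?_
  have : pending 0 H' ≤ H'.length := List.countP_le_length
  rw [hsum]
  omega

end Correctness

/-! ### Law of the final set and conclusion -/

theorem effRun_map_final {n : ℕ} (G : SimpleGraph (Fin n)) (ε : ℝ) (hε : 0 < ε)
    (thr : Fin n → ℝ) (k : ℕ) :
    (effRun G ε thr k).map (fun c => c.state.V) =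
      (naiveRun G ε hε thr k).map (fun c => c.state) := by
  have h := congrArg (PMF.map fun l : List (Finset (Fin n)) => l.getLast?.getD ∅)
    (effRun_map_trace (G := G) (thr := thr) hε k)
  rw [PMF.map_comp, PMF.map_comp] at h
  rw [pmf_map_congr (effRun G ε thr k) (g := (fun l : List (Finset (Fin n)) => l.getLast?.getD ∅) ∘
      LoopCfg.trace) fun c hc => by
      simp [getLast_trace_of_mem_support_loopRun _ _ _ _ c hc], h]
  exact pmf_map_congr _ fun c hc => by
    simp [getLast_trace_of_mem_support_loopRun _ _ _ _ c hc]

end Peeling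

end

theorem mainTheorem9 :
    (∀ (n : ℕ) (G : SimpleGraph (Fin n)) (ε : ℝ) (hε : 0 < ε) (thr : Fin n → ℝ),
      (∀ k : ℕ, (Peeling.effRun G ε thr k).map Peeling.LoopCfg.observe =
        (Peeling.naiveRun G ε hε thr k).map Peeling.LoopCfg.observe) ∧
      (∀ c ∈ (Peeling.effRun G ε thr (n + 1)).support, c.done = true) ∧
      (∀ c ∈ (Peeling.naiveRun G ε hε thr (n + 1)).support, c.done = true) ∧
      (Peeling.effRun G ε thr (n + 1)).map (fun c => c.state.V) =
        (Peeling.naiveRun G ε hε thr (n + 1)).map (fun c => c.state)) ∧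
    (∃ C : ℕ, ∀ (n : ℕ) (G : SimpleGraph (Fin n)) (ε : ℝ), 0 < ε → ∀ (thr : Fin n → ℝ),
      ∀ c ∈ (Peeling.effRun G ε thr (n + 1)).support,
        c.state.work ≤ C * (n + G.edgeSet.ncard + 1)) ∧
    ∃ (P : Peeling.Cmd) (C a : ℕ),
      ∀ (n : ℕ) (G : SimpleGraph (Fin n)) (ε : ℝ), 0 < ε → ∀ (thr : Fin n → ℝ)
        (nbrs : Fin n → List (Fin n)), Peeling.IsAdjacencyLists G nbrs →
        (Peeling.runFor ([P], Peeling.inputStore nbrs ε thr)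
            (C * (n + G.edgeSet.ncard + 1) * Nat.log 2 (n + G.edgeSet.ncard + 2) ^ a)).map
            (Peeling.outputTrace n) =
          (Peeling.effRun G ε thr (n + 1)).map (fun c => some c.trace) := by

  -- The running time of the program is linear, so the exponent of the logarithm can be `0`.
  refine ⟨fun n G ε hε thr => ⟨Peeling.effRun_observe_eq G ε thr hε, ?_, ?_,
    Peeling.effRun_map_final G ε hε thr (n + 1)⟩, ⟨8, fun n G ε _ thr =>
      Peeling.work_le_of_mem_support_effRun G ε thr⟩, Peeling.program, 100, 0,
      fun n G ε hε thr nbrs hadj => ?_⟩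
  · exact Peeling.done_of_mem_support_loopRun
      (Peeling.subset_of_mem_support_effBody G ε thr) _
  · exact Peeling.done_of_mem_support_loopRun
      (Peeling.subset_of_mem_support_naiveBody G ε thr hε) _
  · exact Peeling.outputs_program hε hadj _ (by simp)
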